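/- Let $a<b$, $T>0$, $K_1,K_2\ge 0$ with $K_1^2+K_2^2\ne 0$, and let either $(p,q)=(1,0)$ and $1<\alpha<2$, or $(p,q)=(1,-1)$ and $\frac{1+\sqrt{73}}{6}<\alpha<2$. Consider the problem $$\partial_t u = K_1\,{}_aD_x^\alpha u + K_2\,{}_xD_b^\alpha u + f \ \text{ on } (a,b)\times(0,T],\qquad u(x,0)=u_0(x),\quad u(a,t)=\phi_a(t),\quad u(b,t)=\phi_b(t),$$ where ${}_aD_x^\alpha$ and ${}_xD_b^\alpha$ are the left and right Riemann–Liouville derivatives in $x$, $f$ is continuous on $[a,b]\times[0,T]$, $\phi_a\equiv 0$ if $K_1\neq 0$, and $\phi_b\equiv 0$ if $K_2\ne 0$. Let $u$ be a solution that is smooth in the following sense: $u$ extends from $[a,b]\times[0,T]$ to a $C^7$ function $v$ on $\mathbb{R}^2$ such that $v(x,t)=0$ for $x<a$, $0\le t\le T$ if $K_1\ne0$, and $v(x,t)=0$ for $x>b$, $0\le t\le T$ if $K_2\neq 0$. Let $g_k=(-1)^k\binom{\alpha}{k}$ for $k\ge 0$, $g_k=0$ for $k<0$, and put $$\mu_1=\tfrac{\alpha-2q}{2(p-q)},\quad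 \mu_2=\tfrac{2p-\alpha}{2(p-q)},\quad w_k=\mu_1 g_{k+p-1}+\mu_2 g_{k+q-1},\quad a_r=\tfrac{1}{24}(\alpha+3\alpha^2-12\alpha r+12r^2),\quad c_2=\mu_1a_p+\mu_2a_q .$$ For positive integers $N,M$ let $h=(b-a)/N$, $\tau=T/M$, $x_i=a+ih$, $t_n=n\tau$, $f_i^{n+1/2}=f(x_i,\tfrac{t_n+t_{n+1}}2)$, and $\mathcal C_xV_i=V_i+c_2(V_{i-1}-2V_i+V_{i+1})$. Let $U_i^n$ ($0\le i\le N$, $0\le n\le M$) satisfy $U_i^0=u_0(x_i)$, $U_0^n=\phi_a(t_n)$, $U_N^n=\phi_b(t_n)$ and the compact Crank–Nicolson scheme $$\mathcal C_xU_i^{n+1}-\tfrac{K_1\tau}{2h^\alpha}\sum_{k=0}^{i+1}w_kU_{i-k+1}^{n+1}-\tfrac{K_2\tau}{2h^\alpha}\sum_{k=0}^{N-i+1}w_kU_{i+k-1}^{n+1} =\mathcal C_xU_i^{n}+\tfrac{K_1\tau}{2h^\alpha}\sum_{k=0}^{i+1}w_kU_{i-k+1}^{n}+\tfrac{K_2\tau}{2h^\alpha}\sum_{k=0}^{N-i+1}w_kU_{i+k-1}^{n}+\tau\,\mathcal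 C_xf_i^{n+1/2}$$ for $1\le i\le N-1$, $0\le n\le M-1$. Then there is a constant $c>0$, independent of $N$, $M$ and $n$, such that $$\Big(h\sum_{i=1}^{N-1}\big(u(x_i,t_n)-U_i^n\big)^2\Big)^{1/2}\le c\,(\tau^2+h^3),\qquad 1\le n\le M .$$ -/

import Mathlib

open Set

noncomputable section

namespace CompactFD

/-! ### Riemann-Liouville derivatives and the continuous problem -/

/-- The left Riemann-Liouville derivative of order `α ≥ 0` with base point `a`: for `n - 1 < α < n`
it is `(1 / Γ(n - α)) (d/dx)^n ∫_a^x g(ξ) / (x - ξ)^(α - n + 1) dξ`, and for `α = n` it is the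
classical `n`-th derivative. -/
def leftRL (a α : ℝ) (g : ℝ → ℝ) (x : ℝ) : ℝ :=
  if α = (⌈α⌉₊ : ℝ) then iteratedDeriv ⌈α⌉₊ g x
  else 1 / Real.Gamma ((⌈α⌉₊ : ℝ) - α) *
    iteratedDeriv ⌈α⌉₊ (fun y => ∫ ξ in a..y, g ξ / (y - ξ) ^ (α - (⌈α⌉₊ : ℝ) + 1)) x

/-- The right Riemann-Liouville derivative of order `α ≥ 0` with end point `b`. -/
def rightRL (b α : ℝ) (g : ℝ → ℝ) (x : ℝ) : ℝ :=
  if α = (⌈α⌉₊ : ℝ) then (-1) ^ ⌈α⌉₊ * iteratedDeriv ⌈α⌉₊ g x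
  else (-1) ^ ⌈α⌉₊ / Real.Gamma ((⌈α⌉₊ : ℝ) - α) *
    iteratedDeriv ⌈α⌉₊ (fun y => ∫ ξ in y..b, g ξ / (ξ - y) ^ (α - (⌈α⌉₊ : ℝ) + 1)) x

/-- `u = u(x, t)` solves the two-sided fractional diffusion problem
`u_t = K₁ · leftRL + K₂ · rightRL + f` on `(a, b) × (0, T]` with initial datum `u₀` and boundary data
`φa`, `φb`. The time derivative is taken within `[0, T]`, so it is one-sided at `t = T`. -/
structure IsSolution (a b T α K₁ K₂ : ℝ) (f : ℝ → ℝ → ℝ) (u₀ φa φb : ℝ → ℝ)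
    (u : ℝ → ℝ → ℝ) : Prop where
  equation : ∀ x ∈ Ioo a b, ∀ t ∈ Ioc 0 T,
    HasDerivWithinAt (fun s => u x s)
      (K₁ * leftRL a α (fun y => u y t) x + K₂ * rightRL b α (fun y => u y t) x + f x t)
      (Icc 0 T) t
  initial : ∀ x ∈ Icc a b, u x 0 = u₀ x
  boundary_left : ∀ t ∈ Icc 0 T, u a t = φa t
  boundary_right : ∀ t ∈ Icc 0 T, u b t = φb t

/-- Regularity of the solution: `u` extends from `[a, b] × [0, T]` to a `C^7` function `v` on the
plane, where the extension is by zero to the left of `a` if the left derivative is present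
(`K₁ ≠ 0`), and by zero to the right of `b` if the right derivative is present (`K₂ ≠ 0`). -/
def SufficientlySmooth (a b T K₁ K₂ : ℝ) (u : ℝ → ℝ → ℝ) : Prop :=
  ∃ v : ℝ × ℝ → ℝ, ContDiff ℝ 7 v ∧
    (∀ x ∈ Icc a b, ∀ t ∈ Icc 0 T, v (x, t) = u x t) ∧
    (K₁ ≠ 0 → ∀ x < a, ∀ t ∈ Icc 0 T, v (x, t) = 0) ∧
    (K₂ ≠ 0 → ∀ x > b, ∀ t ∈ Icc 0 T, v (x, t) = 0)

/-! ### The compact difference scheme -/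

/-- `g_k = (-1)^k (α choose k)`, the `k`-th power series coefficient of `(1 - z)^α`. -/
def grunwald (α : ℝ) (k : ℕ) : ℝ := (-1) ^ k * Ring.choose α k

/-- `g_k` for an integer index, with `g_k = 0` for `k < 0`. -/
def grunwaldInt (α : ℝ) (k : ℤ) : ℝ := if 0 ≤ k then grunwald α k.toNat else 0

/-- `μ₁ = (α - 2q) / (2(p - q))`. -/
def mu₁ (α : ℝ) (p q : ℤ) : ℝ := (α - 2 * q) / (2 * (p - q))

/-- `μ₂ = (2p - α) / (2(p - q))`. -/
def mu₂ (α : ℝ) (p q : ℤ) : ℝ := (2 * p - α) / (2 * (p - q))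

/-- The weight `w_k` multiplying `u(x - (k - 1) h)` in the weighted and shifted Grünwald
difference with shifts `(p, q)`. -/
def weight (α : ℝ) (p q : ℤ) (k : ℕ) : ℝ :=
  mu₁ α p q * grunwaldInt α (k + p - 1) + mu₂ α p q * grunwaldInt α (k + q - 1)

/-- The coefficient of `z^2` in the expansion of `((1 - e^(-z)) / z)^α e^(pz)`. -/
def shiftCoeff₂ (α : ℝ) (p : ℤ) : ℝ := (α + 3 * α ^ 2 - 12 * α * p + 12 * p ^ 2) / 24

/-- `c = μ₁ a_p + μ₂ a_q`, where `a_p` is `shiftCoeff₂ α p`. -/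
def compactCoeff (α : ℝ) (p q : ℤ) : ℝ :=
  mu₁ α p q * shiftCoeff₂ α p + mu₂ α p q * shiftCoeff₂ α q

/-- The second central difference of a grid function at an interior node `i ≥ 1`. -/
def secondDiff (h : ℝ) (V : ℕ → ℝ) (i : ℕ) : ℝ := (V (i - 1) - 2 * V i + V (i + 1)) / h ^ 2

/-- The compact operator `1 + c h² δ²` at an interior node `i ≥ 1`. -/
def compactOp (α : ℝ) (p q : ℤ) (h : ℝ) (V : ℕ → ℝ) (i : ℕ) : ℝ :=
  V i + compactCoeff α p q * h ^ 2 * secondDiff h V i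

/-- `h^(-α) ∑_{k=0}^{i+1} w_k V_{i-k+1}`. -/
def leftDiff (α : ℝ) (p q : ℤ) (h : ℝ) (V : ℕ → ℝ) (i : ℕ) : ℝ :=
  1 / h ^ α * ∑ k ∈ Finset.range (i + 2), weight α p q k * V (i + 1 - k)

/-- `h^(-α) ∑_{k=0}^{N-i+1} w_k V_{i+k-1}`, for `1 ≤ i ≤ N - 1`. -/
def rightDiff (α : ℝ) (p q : ℤ) (h : ℝ) (N : ℕ) (V : ℕ → ℝ) (i : ℕ) : ℝ :=
  1 / h ^ α * ∑ k ∈ Finset.range (N - i + 2), weight α p q k * V (i + k - 1)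

/-- The grid function `U n i` (time level `n ≤ M`, node `i ≤ N`) solves the compact
Crank-Nicolson scheme with step sizes `h = (b - a) / N`, `τ = T / M`, nodes `x_i = a + i h`,
`t_n = n τ`, and with the initial and boundary data of the continuous problem. -/
structure IsSchemeSolution (a b T α K₁ K₂ : ℝ) (f : ℝ → ℝ → ℝ) (u₀ φa φb : ℝ → ℝ)
    (p q : ℤ) (N M : ℕ) (h τ : ℝ) (U : ℕ → ℕ → ℝ) : Prop where
  space_step : h = (b - a) / N
  time_step : τ = T / M
  scheme : ∀ n, n < M → ∀ i, 1 ≤ i → i < N →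
    compactOp α p q h (U (n + 1)) i - K₁ * τ / 2 * leftDiff α p q h (U (n + 1)) i
        - K₂ * τ / 2 * rightDiff α p q h N (U (n + 1)) i
      = compactOp α p q h (U n) i + K₁ * τ / 2 * leftDiff α p q h (U n) i
        + K₂ * τ / 2 * rightDiff α p q h N (U n) i
        + τ * compactOp α p q h (fun j => f (a + j * h) ((n * τ + (n + 1) * τ) / 2)) i
  initial : ∀ i ≤ N, U 0 i = u₀ (a + i * h)
  boundary_left : ∀ n ≤ M, U n 0 = φa (n * τ)
  boundary_right : ∀ n ≤ M, U n N = φb (n * τ)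

/-- The discrete `L²` norm `(h ∑_{i=1}^{N-1} v_i²)^(1/2)`. -/
def discreteNorm (h : ℝ) (N : ℕ) (v : ℕ → ℝ) : ℝ :=
  Real.sqrt (h * ∑ i ∈ Finset.Icc 1 (N - 1), v i ^ 2)

end CompactFD

end

/-!
The error `e` of the scheme solves the scheme with the truncation error as source, so the theorem
follows from stability and consistency.

*Stability* (`discreteNorm_le_of_scheme`) is an energy estimate: testing the error equation with the
sum of two consecutive time levels makes the left-hand side the increment of the energy
`⟨e, compactOp e⟩`, and the contribution of the difference operators is nonpositive. The energy is
equivalent to the squared discrete `L²` norm since `0 ≤ compactCoeff < 1 / 4`; for the shifts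
`(1, -1)` the last inequality is exactly the condition `(1 + √73) / 6 < α`. The difference operators
are negative semidefinite (`IsDissipative.sum_mul_nonpos`): in terms of the distances between the
grid function and its translates, the quadratic form only involves the partial sums of the weights,
which are nonpositive, and the weights themselves, which are nonnegative except for those at lag
zero and, for the shifts `(1, -1)`, at lag two; the latter is dominated by lag one.

*Consistency* (`exists_consistency`): a `C^7` function which vanishes to the left of `a` is the
convolution of its seventh derivative with the truncated power `y₊^6 / 6!`, and its
Riemann-Liouville derivative of order `α` is the convolution with `y₊^(6-α) / Γ(7-α)`. Hence the
consistency error is the convolution of the seventh derivative with the consistency error of the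
truncated power, `kernelError`. By Laplace inversion on the line `Re z = 1`, the latter is the
integral of `e^(zy) z^(α-7)` times `symbolError (z h)`, where the symbol
`((1 - e^(-w)) / w)^α (μ₁ e^(pw) + μ₂ e^(qw))` of the weighted and shifted Grünwald difference
agrees with the one of the compact operator up to `O(w^3)` (`exists_symbolError_le`). As
`|z|^(α-4)` is integrable on the line, the kernel is `O(h^3)`.

The terms on the right of the interval are reduced to those on the left by reflection. The
differential equation is used at the end points of the interval as well, where it holds by
continuity of the integral expression `fracDeriv` of the fractional derivatives.
-/

noncomputable section

namespace CompactFD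

/-! ### Grünwald weights -/

theorem grunwald_zero (α : ℝ) : grunwald α 0 = 1 := by simp [grunwald]

theorem grunwald_succ (α : ℝ) (k : ℕ) :
    grunwald α (k + 1) = grunwald α k * ((k - α) / (k + 1)) := by
  have h1 : (k.factorial : ℝ) ≠ 0 := by positivity
  have h2 : (k : ℝ) + 1 ≠ 0 := by positivity
  simp only [grunwald, Ring.choose_eq_smul, descPochhammer_succ_right, Polynomial.smeval_mul,
    Polynomial.smeval_sub, Polynomial.smeval_X, Polynomial.smeval_natCast, Nat.factorial_succ,
    smul_eq_mul, Nat.cast_mul, Nat.cast_succ, pow_succ, pow_zero, nsmul_eq_mul]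
  field_simp
  ring

theorem grunwald_one (α : ℝ) : grunwald α 1 = -α := by
  simp [grunwald_succ, grunwald_zero]

theorem grunwald_two (α : ℝ) : grunwald α 2 = α * (α - 1) / 2 := by
  rw [grunwald_succ, grunwald_one]; push_cast; ring

theorem grunwald_three (α : ℝ) : grunwald α 3 = α * (α - 1) * (2 - α) / 6 := by
  rw [grunwald_succ, grunwald_two]; push_cast; ring

theorem grunwald_nonneg {α : ℝ} (h1 : 1 < α) (h2 : α < 2) (k : ℕ) : 0 ≤ grunwald α (k + 2) := by
  induction k with
  | zero => rw [zero_add, grunwald_two]; nlinarith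
  | succ k ih =>
    rw [show k + 1 + 2 = (k + 2) + 1 by ring, grunwald_succ]
    refine mul_nonneg ih (div_nonneg ?_ (by positivity))
    push_cast
    have : (0 : ℝ) ≤ k := by positivity
    linarith

/-- The partial sums of the Grünwald weights are, up to a factor, the weights themselves. -/
theorem mul_sum_grunwald (α : ℝ) (K : ℕ) :
    α * ∑ k ∈ Finset.range (K + 1), grunwald α k = -(K + 1) * grunwald α (K + 1) := by
  induction K with
  | zero => simp [grunwald_zero, grunwald_one]
  | succ K ih =>
    rw [Finset.sum_range_succ, mul_add, ih, grunwald_succ α (K + 1)]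
    have : ((K + 1 : ℕ) : ℝ) + 1 ≠ 0 := by positivity
    field_simp
    push_cast
    ring

theorem sum_grunwald_nonpos {α : ℝ} (h1 : 1 < α) (h2 : α < 2) (K : ℕ) :
    ∑ k ∈ Finset.range (K + 2), grunwald α k ≤ 0 := by
  have h := mul_sum_grunwald α (K + 1)
  have h3 := mul_nonneg (by positivity : (0 : ℝ) ≤ (K + 1 : ℕ) + 1) (grunwald_nonneg h1 h2 K)
  rw [show K + 2 = K + 1 + 1 by ring] at *
  nlinarith

theorem abs_grunwald_le {α : ℝ} (h1 : 1 < α) (h2 : α < 2) (k : ℕ) : |grunwald α k| ≤ 2 := by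
  induction k with
  | zero => simp [grunwald_zero]
  | succ k ih =>
    rcases k with _ | k
    · rw [zero_add, grunwald_one, abs_neg, abs_of_pos (by linarith)]; exact h2.le
    · rw [grunwald_succ, abs_mul]
      have : |(((k + 1 : ℕ) : ℝ) - α) / ((k + 1 : ℕ) + 1)| ≤ 1 := by
        have hk : (0 : ℝ) ≤ k := by positivity
        rw [abs_le]
        push_cast
        constructor
        · rw [le_div_iff₀ (by positivity)]; linarith
        · rw [div_le_one (by positivity)]; linarith
      calc _ ≤ 2 * 1 := mul_le_mul ih this (abs_nonneg _) (by norm_num)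
        _ = 2 := by norm_num

/-- The Grünwald weight with index shifted by `m`, and value zero for negative indices. -/
def shiftedGrunwald (α : ℝ) (m k : ℕ) : ℝ := if m ≤ k then grunwald α (k - m) else 0

theorem grunwaldInt_sub (α : ℝ) (m k : ℕ) :
    grunwaldInt α ((k : ℤ) - m) = shiftedGrunwald α m k := by
  unfold grunwaldInt shiftedGrunwald
  by_cases h : m ≤ k
  · rw [if_pos (by omega), if_pos h]; congr 1; omega
  · rw [if_neg (by omega), if_neg h]

theorem shiftedGrunwald_add (α : ℝ) (m k : ℕ) :
    shiftedGrunwald α m (k + m) = grunwald α k := by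
  simp [shiftedGrunwald]

theorem shiftedGrunwald_of_lt {α : ℝ} {m k : ℕ} (h : k < m) : shiftedGrunwald α m k = 0 := by
  simp [shiftedGrunwald, h]

theorem sum_shiftedGrunwald (α : ℝ) (m K : ℕ) :
    ∑ k ∈ Finset.range (K + m), shiftedGrunwald α m k = ∑ k ∈ Finset.range K, grunwald α k := by
  rw [add_comm, Finset.sum_range_add, Finset.sum_eq_zero, zero_add]
  · exact Finset.sum_congr rfl fun k _ => by rw [add_comm, shiftedGrunwald_add]
  · intro k hk
    exact shiftedGrunwald_of_lt (Finset.mem_range.1 hk)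

theorem abs_shiftedGrunwald_le {α : ℝ} (h1 : 1 < α) (h2 : α < 2) (m k : ℕ) :
    |shiftedGrunwald α m k| ≤ 2 := by
  unfold shiftedGrunwald
  split_ifs
  · exact abs_grunwald_le h1 h2 _
  · simp

/-- The two admissible pairs of shifts are `p = 1`, `q = 1 - m` for `m = 1` and `m = 2`; in this
form both index shifts of the Grünwald weights are natural numbers. -/
theorem weight_eq (α : ℝ) (m k : ℕ) :
    weight α 1 (1 - m) k =
      mu₁ α 1 (1 - m) * grunwald α k + mu₂ α 1 (1 - m) * shiftedGrunwald α m k := by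
  unfold weight
  rw [← grunwaldInt_sub]
  congr 2
  · rw [show (k : ℤ) + 1 - 1 = k by ring]; simp [grunwaldInt]
  · congr 1; ring

/-! ### Negativity of the weighted and shifted Grünwald difference -/

/-- The structural properties of a sequence of weights which make the quadratic form
`∑ i, v i * ∑ k, w k * v (i + 1 - k)` negative semidefinite. The weight `w k` belongs to the
lag `|k - 1|`, so `w 0` and `w 2` both belong to lag one, and `w 3`, which is allowed to be
negative, to lag two. -/
structure IsDissipative (w : ℕ → ℝ) : Prop where
  sum_nonpos : ∀ K, ∑ k ∈ Finset.range (K + 4), w k ≤ 0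
  low : 0 ≤ w 0 + w 2 + 4 * min (w 3) 0
  nonneg : ∀ k, 0 ≤ w (k + 4)

theorem isDissipative_of_shift_one {α : ℝ} (h1 : 1 < α) (h2 : α < 2) :
    IsDissipative (weight α 1 0) := by
  have hw : ∀ k, weight α 1 0 k = α / 2 * grunwald α k + (2 - α) / 2 * shiftedGrunwald α 1 k := by
    intro k
    have := weight_eq α 1 k
    simp only [Nat.cast_one, sub_self] at this
    rw [this]; simp [mu₁, mu₂]
  have hs : ∀ k, shiftedGrunwald α 1 (k + 1) = grunwald α k := shiftedGrunwald_add α 1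
  refine ⟨fun K => ?_, ?_, fun k => ?_⟩
  · simp only [hw, Finset.sum_add_distrib, ← Finset.mul_sum]
    have e1 := sum_grunwald_nonpos h1 h2 (K + 2)
    have e2 := sum_grunwald_nonpos h1 h2 (K + 1)
    have e3 := sum_shiftedGrunwald α 1 (K + 3)
    rw [show K + 3 + 1 = K + 4 by ring] at e3
    rw [e3]
    rw [show K + 2 + 2 = K + 4 by ring] at e1
    rw [show K + 1 + 2 = K + 3 by ring] at e2
    nlinarith
  · have w3 : 0 ≤ weight α 1 0 3 := by
      rw [hw, hs 2, grunwald_two, grunwald_three]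
      have : 0 ≤ α * (α - 1) := by nlinarith
      have h3 : 0 ≤ α * (α - 1) * (2 - α) := mul_nonneg this (by linarith)
      have h4 : 0 ≤ α * (α * (α - 1) * (2 - α)) := mul_nonneg (by linarith) h3
      nlinarith
    rw [min_eq_right w3, hw, hw, hs 1, grunwald_one, grunwald_two, grunwald_zero,
      shiftedGrunwald_of_lt (by norm_num)]
    nlinarith [mul_nonneg (by linarith : 0 ≤ α) (by nlinarith : 0 ≤ (α + 2) * (α - 1))]
  · rw [hw, hs (k + 3)]
    have := grunwald_nonneg h1 h2 (k + 2)
    have := grunwald_nonneg h1 h2 (k + 1)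
    have a1 : 0 ≤ α / 2 := by linarith
    have a2 : 0 ≤ (2 - α) / 2 := by linarith
    positivity

theorem isDissipative_of_shift_two {α : ℝ} (h1 : 1 < α) (h2 : α < 2) :
    IsDissipative (weight α 1 (-1)) := by
  have hw : ∀ k, weight α 1 (-1) k =
      (α + 2) / 4 * grunwald α k + (2 - α) / 4 * shiftedGrunwald α 2 k := by
    intro k
    have := weight_eq α 2 k
    simp only [Nat.cast_two] at this
    rw [show (1 : ℤ) - 2 = -1 by norm_num] at this
    rw [this]
    congr 2
    · simp [mu₁]; ring
    · simp [mu₂]; ring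
  have hs : ∀ k, shiftedGrunwald α 2 (k + 2) = grunwald α k := shiftedGrunwald_add α 2
  refine ⟨fun K => ?_, ?_, fun k => ?_⟩
  · simp only [hw, Finset.sum_add_distrib, ← Finset.mul_sum]
    have e1 := sum_grunwald_nonpos h1 h2 (K + 2)
    have e2 := sum_grunwald_nonpos h1 h2 K
    have e3 := sum_shiftedGrunwald α 2 (K + 2)
    rw [show K + 2 + 2 = K + 4 by ring] at e3 e1
    rw [e3]
    nlinarith
  · rw [hw, hw, hw, hs 0, hs 1, grunwald_one, grunwald_two, grunwald_zero, grunwald_three,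
      shiftedGrunwald_of_lt (by norm_num)]
    rcases min_cases ((α + 2) / 4 * (α * (α - 1) * (2 - α) / 6) + (2 - α) / 4 * -α) 0 with h | h
    · rw [h.1]
      -- with `s = α - 1` this is a polynomial in `s` on `(0, 1)` vanishing at `s = 0`
      obtain ⟨s, rfl⟩ : ∃ s, α = 1 + s := ⟨α - 1, by ring⟩
      have hs0 : 0 < s := by linarith
      have hs1 : s < 1 := by linarith
      have h3 : s ^ 3 ≤ s := by
        nlinarith [mul_pos hs0 (by linarith : 0 < 1 - s), pow_pos hs0 2, pow_pos hs0 3]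
      have h4 : s ^ 4 ≤ s ^ 2 := by nlinarith
      nlinarith [sq_nonneg s]
    · rw [h.1]
      nlinarith [mul_nonneg (by linarith : 0 ≤ α + 2) (by nlinarith : 0 ≤ α * (α - 1))]
  · rw [hw, hs (k + 2)]
    have := grunwald_nonneg h1 h2 (k + 2)
    have := grunwald_nonneg h1 h2 k
    have a1 : 0 ≤ (α + 2) / 4 := by linarith
    have a2 : 0 ≤ (2 - α) / 4 := by linarith
    positivity

/-- The autocorrelation `∑ i, v i * v (i - m)` of a two-sided sequence. -/
def autocorr (v : ℤ → ℝ) (m : ℤ) : ℝ := ∑' i, v i * v (i - m)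

/-- The squared `ℓ²` norm of the difference of a sequence and its translate by `m`. -/
def translateDist (v : ℤ → ℝ) (m : ℤ) : ℝ := ∑' i, (v i - v (i - m)) ^ 2

section finite_support

variable {v : ℤ → ℝ}

theorem finite_support_translate (hv : v.support.Finite) (m : ℤ) :
    (fun i => v (i - m)).support.Finite := by
  have : (fun i => v (i - m)).support = (fun i => i - m) ⁻¹' v.support := rfl
  rw [this]
  exact hv.preimage (sub_left_injective.injOn)

theorem summable_of_zero (hv : v.support.Finite) {f : ℤ → ℝ} (m : ℤ)
    (hf : ∀ i, v i = 0 → v (i - m) = 0 → f i = 0) : Summable f := by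
  refine summable_of_hasFiniteSupport ((hv.union (finite_support_translate hv m)).subset ?_)
  intro i hi
  by_contra h
  simp only [mem_union, Function.mem_support, not_or, not_not] at h
  exact hi (hf i h.1 h.2)

theorem translateDist_nonneg (m : ℤ) : 0 ≤ translateDist v m := tsum_nonneg fun _ => sq_nonneg _

theorem translateDist_zero : translateDist v 0 = 0 := by simp [translateDist]

theorem autocorr_eq (hv : v.support.Finite) (m : ℤ) :
    autocorr v m = autocorr v 0 - translateDist v m / 2 := by
  have h0 : autocorr v 0 = ∑' i, v (i - m) ^ 2 := by
    unfold autocorr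
    rw [← (Equiv.subRight m).tsum_eq]
    simp [sq]
  have h0' : autocorr v 0 = ∑' i, v i ^ 2 := by simp [autocorr, sq]
  have h : translateDist v m = ∑' i, v i ^ 2 + ∑' i, v (i - m) ^ 2 - 2 * autocorr v m := by
    unfold translateDist autocorr
    rw [← tsum_mul_left, ← Summable.tsum_add, ← Summable.tsum_sub]
    · exact tsum_congr fun i => by ring
    all_goals
      refine summable_of_zero hv m fun i h1 h2 => ?_
      simp [h1, h2]
  rw [h, ← h0, ← h0']
  ring

theorem translateDist_neg (m : ℤ) : translateDist v (-m) = translateDist v m := by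
  unfold translateDist
  rw [← (Equiv.subRight m).tsum_eq]
  refine tsum_congr fun i => ?_
  simp only [Equiv.subRight_apply, sub_neg_eq_add, sub_add_cancel]
  ring

theorem translateDist_two_le (hv : v.support.Finite) :
    translateDist v 2 ≤ 4 * translateDist v 1 := by
  have h0 : translateDist v 1 = ∑' i, (v (i - 1) - v (i - 2)) ^ 2 := by
    unfold translateDist
    rw [← (Equiv.subRight 1).tsum_eq]
    refine tsum_congr fun i => ?_
    simp only [Equiv.subRight_apply, sub_sub]
    norm_num
  have s1 : Summable fun i => (v i - v (i - 1)) ^ 2 :=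
    summable_of_zero hv 1 fun i h1 h2 => by simp [h1, h2]
  have s2 : Summable fun i => (v i - v (i - 2)) ^ 2 :=
    summable_of_zero hv 2 fun i h1 h2 => by simp [h1, h2]
  have s3 : Summable fun i => (v (i - 1) - v (i - 2)) ^ 2 := by
    have := (Equiv.subRight (1 : ℤ)).summable_iff.2 s1
    refine this.congr fun i => ?_
    simp only [Function.comp_apply, Equiv.subRight_apply, sub_sub]
    norm_num
  have : translateDist v 2 ≤ 2 * translateDist v 1 + 2 * translateDist v 1 := by
    nth_rewrite 2 [h0]
    unfold translateDist
    rw [← tsum_mul_left, ← tsum_mul_left, ← Summable.tsum_add (s1.mul_left 2) (s3.mul_left 2)]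
    refine s2.tsum_le_tsum (fun i => ?_) ((s1.mul_left 2).add (s3.mul_left 2))
    nlinarith [sq_nonneg (v i - 2 * v (i - 1) + v (i - 2))]
  linarith

/-- The quadratic form of a dissipative sequence of weights is negative semidefinite. The
correlations are rewritten as `autocorr v 0` minus half of `translateDist v (k - 1)`, and the
distance at lag `2`, whose weight may be negative, is controlled by the one at lag `1`. -/
theorem IsDissipative.sum_autocorr_nonpos {w : ℕ → ℝ} (hw : IsDissipative w)
    (hv : v.support.Finite) (K : ℕ) :
    ∑ k ∈ Finset.range (K + 4), w k * autocorr v (k - 1) ≤ 0 := by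
  have h1 : ∑ k ∈ Finset.range (K + 4), w k * autocorr v (k - 1) =
      (∑ k ∈ Finset.range (K + 4), w k) * autocorr v 0 -
        1 / 2 * ∑ k ∈ Finset.range (K + 4), w k * translateDist v (k - 1) := by
    rw [Finset.sum_mul, Finset.mul_sum, ← Finset.sum_sub_distrib]
    refine Finset.sum_congr rfl fun k _ => ?_
    rw [autocorr_eq hv]
    ring
  have h0 : 0 ≤ autocorr v 0 := tsum_nonneg fun i => by simp [mul_self_nonneg]
  have h2 : 0 ≤ ∑ k ∈ Finset.range (K + 4), w k * translateDist v (k - 1) := by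
    rw [add_comm K 4, Finset.sum_range_add]
    refine add_nonneg ?_ (Finset.sum_nonneg fun k _ => ?_)
    · simp only [Finset.sum_range_succ, Finset.sum_range_zero]
      norm_num
      rw [translateDist_neg, translateDist_zero]
      have d1 := translateDist_nonneg (v := v) 1
      have d2 := translateDist_nonneg (v := v) 2
      have d3 := translateDist_two_le hv
      have := hw.low
      rcases min_cases (w 3) 0 with h | h <;> rw [h.1] at this
      · nlinarith
      · nlinarith [mul_nonneg h.2.le d2, mul_nonneg this d1]
    · rw [add_comm 4 k]
      exact mul_nonneg (hw.nonneg k) (translateDist_nonneg _)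
  rw [h1]
  nlinarith [mul_nonneg (neg_nonneg.2 (hw.sum_nonpos K)) h0]

end finite_support

/-- The difference operator of a dissipative sequence of weights is negative semidefinite on
grid functions with zero boundary values. -/
theorem IsDissipative.sum_mul_nonpos {w : ℕ → ℝ} (hw : IsDissipative w) {N : ℕ} {e : ℕ → ℝ}
    (h0 : e 0 = 0) (hN : e N = 0) :
    ∑ i ∈ Finset.Icc 1 (N - 1), e i * ∑ k ∈ Finset.range (i + 2), w k * e (i + 1 - k) ≤ 0 := by
  set v : ℤ → ℝ := fun j => if 0 < j ∧ j < N then e j.toNat else 0 with hvdef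
  have hve : ∀ j : ℕ, j ≤ N → v j = e j := by
    intro j hj
    simp only [hvdef]
    split_ifs with h
    · simp
    · rcases Nat.eq_zero_or_pos j with rfl | hp
      · exact h0.symm
      · have : j = N := by omega
        rw [this, hN]
  have hv0 : ∀ j : ℤ, ¬ (0 < j ∧ j < N) → v j = 0 := fun j hj => if_neg hj
  have hv : v.support.Finite := by
    refine (finite_Icc (0 : ℤ) N).subset fun j hj => ?_
    by_contra h
    refine hj (hv0 j fun h' => h ⟨h'.1.le, h'.2.le⟩)
  have hc : ∀ m, autocorr v m = ∑ i ∈ Finset.Icc 1 (N - 1), e i * v (i - m) := by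
    intro m
    unfold autocorr
    rw [tsum_eq_sum (s := (Finset.Icc 1 (N - 1)).map Nat.castEmbedding)]
    · rw [Finset.sum_map]
      refine Finset.sum_congr rfl fun i hi => ?_
      rw [Finset.mem_Icc] at hi
      simp only [Nat.castEmbedding_apply]
      rw [hve i (by omega)]
    · intro j hj
      rw [hv0 j, zero_mul]
      rintro ⟨hj1, hj2⟩
      refine hj (Finset.mem_map.2 ⟨j.toNat, Finset.mem_Icc.2 ⟨by omega, by omega⟩, ?_⟩)
      simp only [Nat.castEmbedding_apply]
      omega
  have key := hw.sum_autocorr_nonpos hv (N + 2)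
  simp only [hc, Finset.mul_sum] at key
  rw [Finset.sum_comm] at key
  refine le_of_eq_of_le (Finset.sum_congr rfl fun i hi => ?_) key
  rw [Finset.mem_Icc] at hi
  rw [Finset.mul_sum]
  have : Finset.range (i + 2) ⊆ Finset.range (N + 2 + 4) := by
    intro k hk; rw [Finset.mem_range] at *; omega
  rw [← Finset.sum_subset this]
  · refine Finset.sum_congr rfl fun k hk => ?_
    rw [Finset.mem_range] at hk
    rw [← hve (i + 1 - k)]
    · rw [show (i : ℤ) - (k - 1) = ((i + 1 - k : ℕ) : ℤ) by omega]; ring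
    · rcases Nat.eq_zero_or_pos k with rfl | hk <;> omega
  · intro k _ hk
    rw [Finset.mem_range] at hk
    rw [hv0 (i - (k - 1))]
    · ring
    · rintro ⟨h1, h2⟩; omega

theorem sum_mul_leftDiff_nonpos {α : ℝ} {p q : ℤ} (hw : IsDissipative (weight α p q)) {h : ℝ}
    (hh : 0 < h) {N : ℕ} {e : ℕ → ℝ} (h0 : e 0 = 0) (hN : e N = 0) :
    ∑ i ∈ Finset.Icc 1 (N - 1), e i * leftDiff α p q h e i ≤ 0 := by
  have := hw.sum_mul_nonpos h0 hN
  have h1 : 0 ≤ 1 / h ^ α := by positivity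
  calc _ = 1 / h ^ α * ∑ i ∈ Finset.Icc 1 (N - 1),
        e i * ∑ k ∈ Finset.range (i + 2), weight α p q k * e (i + 1 - k) := by
        rw [Finset.mul_sum]
        exact Finset.sum_congr rfl fun i _ => by unfold leftDiff; ring
    _ ≤ 0 := mul_nonpos_of_nonneg_of_nonpos h1 this

/-- The right difference operator is the left one after reversal of the grid. -/
theorem rightDiff_eq (α : ℝ) (p q : ℤ) (h : ℝ) {N : ℕ} (V : ℕ → ℝ) {i : ℕ} (h1 : 1 ≤ i)
    (h2 : i < N) :
    rightDiff α p q h N V i = leftDiff α p q h (fun j => V (N - j)) (N - i) := by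
  unfold rightDiff leftDiff
  congr 1
  refine Finset.sum_congr rfl fun k hk => ?_
  rw [Finset.mem_range] at hk
  congr 2
  omega

theorem sum_Icc_reflect (N : ℕ) (F : ℕ → ℝ) :
    ∑ i ∈ Finset.Icc 1 (N - 1), F (N - i) = ∑ i ∈ Finset.Icc 1 (N - 1), F i := by
  refine Finset.sum_nbij' (fun i => N - i) (fun i => N - i) ?_ ?_ ?_ ?_ (fun _ _ => rfl) <;>
    intro i hi <;> rw [Finset.mem_Icc] at * <;> omega

theorem sum_mul_rightDiff_nonpos {α : ℝ} {p q : ℤ} (hw : IsDissipative (weight α p q)) {h : ℝ}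
    (hh : 0 < h) {N : ℕ} {e : ℕ → ℝ} (h0 : e 0 = 0) (hN : e N = 0) :
    ∑ i ∈ Finset.Icc 1 (N - 1), e i * rightDiff α p q h N e i ≤ 0 := by
  have := sum_mul_leftDiff_nonpos hw hh (N := N) (e := fun j => e (N - j)) (by simpa) (by simpa)
  rw [← sum_Icc_reflect] at this
  refine le_of_eq_of_le (Finset.sum_congr rfl fun i hi => ?_) this
  rw [Finset.mem_Icc] at hi
  rw [rightDiff_eq _ _ _ _ _ hi.1 (by omega), show N - (N - i) = i by omega]

/-! ### The energy of the compact operator -/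

theorem compactOp_eq (α : ℝ) (p q : ℤ) {h : ℝ} (hh : h ≠ 0) (V : ℕ → ℝ) (i : ℕ) :
    compactOp α p q h V i = V i + compactCoeff α p q * (V (i - 1) - 2 * V i + V (i + 1)) := by
  unfold compactOp secondDiff
  field_simp

/-- Summation by parts for the second difference. -/
theorem sum_mul_secondDiff (n : ℕ) (a b : ℕ → ℝ) :
    ∑ i ∈ Finset.Icc 1 n, a i * (b (i - 1) - 2 * b i + b (i + 1)) =
      a (n + 1) * (b (n + 1) - b n) - a 0 * (b 1 - b 0) -
        ∑ i ∈ Finset.range (n + 1), (a (i + 1) - a i) * (b (i + 1) - b i) := by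
  induction n with
  | zero => simp; ring
  | succ n ih =>
    rw [Finset.sum_Icc_succ_top (by omega), ih, Finset.sum_range_succ _ (n + 1)]
    simp only [Nat.add_sub_cancel]
    ring

/-- The inner product `∑ i, a i * (compactOp b) i`, written symmetrically by summation by parts. -/
def energy (c : ℝ) (N : ℕ) (a b : ℕ → ℝ) : ℝ :=
  ∑ i ∈ Finset.Icc 1 (N - 1), a i * b i -
    c * ∑ i ∈ Finset.range N, (a (i + 1) - a i) * (b (i + 1) - b i)

theorem sum_mul_compactOp (α : ℝ) (p q : ℤ) {h : ℝ} (hh : h ≠ 0) {N : ℕ} (h1 : 1 ≤ N)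
    {a : ℕ → ℝ} (b : ℕ → ℝ) (h0 : a 0 = 0) (hN : a N = 0) :
    ∑ i ∈ Finset.Icc 1 (N - 1), a i * compactOp α p q h b i =
      energy (compactCoeff α p q) N a b := by
  have := sum_mul_secondDiff (N - 1) a b
  rw [Nat.sub_add_cancel h1, h0, hN] at this
  have h2 : ∀ i, a i * compactOp α p q h b i =
      a i * b i + compactCoeff α p q * (a i * (b (i - 1) - 2 * b i + b (i + 1))) := by
    intro i
    rw [compactOp_eq α p q hh]
    ring
  simp only [h2, Finset.sum_add_distrib, ← Finset.mul_sum, this, energy]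
  ring

theorem energy_sub (c : ℝ) (N : ℕ) (a b : ℕ → ℝ) :
    energy c N (fun i => a i + b i) (fun i => a i - b i) = energy c N a a - energy c N b b := by
  simp only [energy, Finset.mul_sum]
  rw [← sub_add_eq_sub_sub_swap, eq_sub_iff_add_eq]
  have h1 : ∑ i ∈ Finset.Icc 1 (N - 1), (a i + b i) * (a i - b i) =
      ∑ i ∈ Finset.Icc 1 (N - 1), a i * a i - ∑ i ∈ Finset.Icc 1 (N - 1), b i * b i := by
    rw [← Finset.sum_sub_distrib]
    exact Finset.sum_congr rfl fun i _ => by ring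
  have h2 : ∑ i ∈ Finset.range N,
      c * ((a (i + 1) + b (i + 1) - (a i + b i)) * (a (i + 1) - b (i + 1) - (a i - b i))) =
      ∑ i ∈ Finset.range N, c * ((a (i + 1) - a i) * (a (i + 1) - a i)) -
        ∑ i ∈ Finset.range N, c * ((b (i + 1) - b i) * (b (i + 1) - b i)) := by
    rw [← Finset.sum_sub_distrib]
    exact Finset.sum_congr rfl fun i _ => by ring
  rw [h1, h2]
  ring

theorem energy_le {c : ℝ} (hc : 0 ≤ c) (N : ℕ) (a : ℕ → ℝ) :
    energy c N a a ≤ ∑ i ∈ Finset.Icc 1 (N - 1), a i ^ 2 := by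
  unfold energy
  have : 0 ≤ ∑ i ∈ Finset.range N, (a (i + 1) - a i) * (a (i + 1) - a i) :=
    Finset.sum_nonneg fun _ _ => mul_self_nonneg _
  simp only [sq]
  nlinarith

theorem le_energy {c : ℝ} (hc : 0 ≤ c) {N : ℕ} (h1 : 1 ≤ N) {a : ℕ → ℝ} (h0 : a 0 = 0)
    (hN : a N = 0) :
    (1 - 4 * c) * ∑ i ∈ Finset.Icc 1 (N - 1), a i ^ 2 ≤ energy c N a a := by
  obtain ⟨n, rfl⟩ : ∃ n, N = n + 1 := ⟨N - 1, by omega⟩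
  have e1 : ∑ i ∈ Finset.Icc 1 n, a i ^ 2 = ∑ i ∈ Finset.range n, a (i + 1) ^ 2 := by
    rw [Finset.range_eq_Ico, Finset.sum_Ico_add' (fun i => a i ^ 2) 0 n 1]
    rfl
  have e2 : ∑ i ∈ Finset.range (n + 1), (a (i + 1) - a i) * (a (i + 1) - a i) ≤
      ∑ i ∈ Finset.range (n + 1), (2 * a (i + 1) ^ 2 + 2 * a i ^ 2) :=
    Finset.sum_le_sum fun i _ => by nlinarith [sq_nonneg (a (i + 1) + a i)]
  rw [Finset.sum_add_distrib, ← Finset.mul_sum, ← Finset.mul_sum,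
    Finset.sum_range_succ (fun i => a (i + 1) ^ 2), Finset.sum_range_succ' (fun i => a i ^ 2), h0,
    hN] at e2
  simp only [energy, Nat.add_sub_cancel]
  have e3 : ∑ i ∈ Finset.Icc 1 n, a i * a i = ∑ i ∈ Finset.range n, a (i + 1) ^ 2 := by
    rw [← e1]; exact Finset.sum_congr rfl fun i _ => by ring
  rw [e3, e1]
  nlinarith [mul_le_mul_of_nonneg_left e2 hc]

theorem compactCoeff_bounds {α : ℝ} {p q : ℤ} (hα : (p = 1 ∧ q = 0 ∧ 1 < α ∧ α < 2) ∨
      (p = 1 ∧ q = -1 ∧ (1 + Real.sqrt 73) / 6 < α ∧ α < 2)) :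
    0 ≤ compactCoeff α p q ∧ compactCoeff α p q < 1 / 4 := by
  rcases hα with ⟨rfl, rfl, h1, h2⟩ | ⟨rfl, rfl, h1, h2⟩
  · have : compactCoeff α 1 0 = α * (7 - 3 * α) / 24 := by
      simp [compactCoeff, mu₁, mu₂, shiftCoeff₂]; ring
    rw [this]
    constructor <;> nlinarith [sq_nonneg (6 * α - 7)]
  · have : compactCoeff α 1 (-1) = (12 + α - 3 * α ^ 2) / 24 := by
      simp [compactCoeff, mu₁, mu₂, shiftCoeff₂]; ring
    rw [this]
    have h3 : (8 : ℝ) < Real.sqrt 73 := Real.lt_sqrt_of_sq_lt (by norm_num)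
    have h4 := Real.sq_sqrt (show (0 : ℝ) ≤ 73 by norm_num)
    constructor <;> nlinarith

theorem one_lt_and_isDissipative {α : ℝ} {p q : ℤ} (hα : (p = 1 ∧ q = 0 ∧ 1 < α ∧ α < 2) ∨
      (p = 1 ∧ q = -1 ∧ (1 + Real.sqrt 73) / 6 < α ∧ α < 2)) :
    1 < α ∧ α < 2 ∧ IsDissipative (weight α p q) := by
  rcases hα with ⟨rfl, rfl, h1, h2⟩ | ⟨rfl, rfl, h1, h2⟩
  · exact ⟨h1, h2, isDissipative_of_shift_one h1 h2⟩
  · have h3 : (8 : ℝ) < Real.sqrt 73 := Real.lt_sqrt_of_sq_lt (by norm_num)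
    have h1' : 1 < α := by linarith
    exact ⟨h1', h2, isDissipative_of_shift_two h1' h2⟩

/-! ### Stability of the Crank-Nicolson scheme -/

/-- One step of the energy estimate: the square root of the energy grows at most by the
size of the residual. -/
theorem sqrt_energy_step {c τ : ℝ} (hc : 0 ≤ c) (hc' : c < 1 / 4) (hτ : 0 ≤ τ) {N : ℕ}
    (hN : 1 ≤ N) {e e' r : ℕ → ℝ} (h0 : e 0 = 0) (hN0 : e N = 0) (h0' : e' 0 = 0)
    (hN0' : e' N = 0)
    (hstep : energy c N e' e' - energy c N e e ≤
      τ * ∑ i ∈ Finset.Icc 1 (N - 1), r i * (e' i + e i)) :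
    Real.sqrt (energy c N e' e') ≤ Real.sqrt (energy c N e e) +
      τ * (Real.sqrt (∑ i ∈ Finset.Icc 1 (N - 1), r i ^ 2) / Real.sqrt (1 - 4 * c)) := by
  have hk : 0 < 1 - 4 * c := by linarith
  have hsk := Real.sqrt_pos.2 hk
  have bound : ∀ a : ℕ → ℝ, a 0 = 0 → a N = 0 →
      ∑ i ∈ Finset.Icc 1 (N - 1), r i * a i ≤
        Real.sqrt (∑ i ∈ Finset.Icc 1 (N - 1), r i ^ 2) / Real.sqrt (1 - 4 * c) *
          Real.sqrt (energy c N a a) := by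
    intro a ha hb
    refine (Real.sum_mul_le_sqrt_mul_sqrt _ r a).trans ?_
    rw [div_mul_eq_mul_div, mul_div_assoc]
    refine mul_le_mul_of_nonneg_left ?_ (Real.sqrt_nonneg _)
    rw [le_div_iff₀ hsk, ← Real.sqrt_mul (Finset.sum_nonneg fun _ _ => sq_nonneg _), mul_comm]
    exact Real.sqrt_le_sqrt (le_energy hc hN ha hb)
  have pos : ∀ a : ℕ → ℝ, a 0 = 0 → a N = 0 → 0 ≤ energy c N a a := fun a ha hb =>
    (mul_nonneg hk.le (Finset.sum_nonneg fun _ _ => sq_nonneg _)).trans (le_energy hc hN ha hb)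
  have b1 := bound e h0 hN0
  have b2 := bound e' h0' hN0'
  simp only [mul_add, Finset.sum_add_distrib] at hstep
  have q1 := Real.sq_sqrt (pos e h0 hN0)
  have q2 := Real.sq_sqrt (pos e' h0' hN0')
  set x := Real.sqrt (energy c N e e)
  set y := Real.sqrt (energy c N e' e')
  set ρ := Real.sqrt (∑ i ∈ Finset.Icc 1 (N - 1), r i ^ 2) / Real.sqrt (1 - 4 * c)
  have hx : 0 ≤ x := Real.sqrt_nonneg _
  have hy : 0 ≤ y := Real.sqrt_nonneg _
  have hρ : 0 ≤ ρ := by positivity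
  have main : (y - x) * (y + x) ≤ τ * ρ * (y + x) := by
    nlinarith [mul_le_mul_of_nonneg_left (add_le_add b2 b1) hτ]
  rcases (add_nonneg hy hx).eq_or_lt with h | h
  · have : y = 0 := by linarith
    rw [this]; positivity
  · linarith [le_of_mul_le_mul_right main h]

/-- Stability of the compact Crank-Nicolson scheme: a grid function with zero initial and boundary
values which satisfies the scheme with right-hand side `r` is controlled by `sup |r|`. -/
theorem discreteNorm_le_of_scheme {α : ℝ} {p q : ℤ} {K₁ K₂ h τ ℓ T ρ : ℝ} {N M : ℕ}
    (hc : 0 ≤ compactCoeff α p q) (hc' : compactCoeff α p q < 1 / 4)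
    (hw : IsDissipative (weight α p q)) (hK₁ : 0 ≤ K₁) (hK₂ : 0 ≤ K₂) (hN : 1 ≤ N) (hh : 0 < h)
    (hℓ : h * N = ℓ) (hτ : 0 ≤ τ) (hT : τ * M = T) (hρ : 0 ≤ ρ) {e r : ℕ → ℕ → ℝ}
    (hinit : ∀ i ≤ N, e 0 i = 0) (hleft : ∀ n ≤ M, e n 0 = 0) (hright : ∀ n ≤ M, e n N = 0)
    (hstep : ∀ n < M, ∀ i, 1 ≤ i → i < N →
      compactOp α p q h (fun j => e (n + 1) j - e n j) i =
        K₁ * τ / 2 * leftDiff α p q h (fun j => e (n + 1) j + e n j) i +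
        K₂ * τ / 2 * rightDiff α p q h N (fun j => e (n + 1) j + e n j) i + τ * r n i)
    (hr : ∀ n < M, ∀ i, 1 ≤ i → i < N → |r n i| ≤ ρ) {n : ℕ} (hn : n ≤ M) :
    discreteNorm h N (e n) ≤ T * Real.sqrt ℓ / (1 - 4 * compactCoeff α p q) * ρ := by
  set c := compactCoeff α p q with hcdef
  have hk : 0 < 1 - 4 * c := by linarith
  have hsk := Real.sqrt_pos.2 hk
  have hres : ∀ n < M, Real.sqrt (∑ i ∈ Finset.Icc 1 (N - 1), r n i ^ 2) ≤ Real.sqrt N * ρ := by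
    intro n hn
    rw [← Real.sqrt_sq hρ, ← Real.sqrt_mul (Nat.cast_nonneg N)]
    refine Real.sqrt_le_sqrt ?_
    calc ∑ i ∈ Finset.Icc 1 (N - 1), r n i ^ 2 ≤ ∑ i ∈ Finset.Icc 1 (N - 1), ρ ^ 2 := by
          refine Finset.sum_le_sum fun i hi => ?_
          rw [Finset.mem_Icc] at hi
          exact sq_le_sq' (abs_le.1 (hr n hn i hi.1 (by omega))).1
            (abs_le.1 (hr n hn i hi.1 (by omega))).2
      _ = ((N - 1 : ℕ) : ℝ) * ρ ^ 2 := by simp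
      _ ≤ N * ρ ^ 2 := mul_le_mul_of_nonneg_right (by exact_mod_cast Nat.sub_le N 1) (sq_nonneg _)
  have hstep' : ∀ n < M, energy c N (e (n + 1)) (e (n + 1)) - energy c N (e n) (e n) ≤
      τ * ∑ i ∈ Finset.Icc 1 (N - 1), r n i * (e (n + 1) i + e n i) := by
    intro n hn
    have z0 : e (n + 1) 0 + e n 0 = 0 := by rw [hleft _ hn, hleft _ hn.le, add_zero]
    have zN : e (n + 1) N + e n N = 0 := by rw [hright _ hn, hright _ hn.le, add_zero]
    rw [← energy_sub, ← sum_mul_compactOp α p q hh.ne' hN _ z0 zN]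
    have l1 := sum_mul_leftDiff_nonpos hw hh (e := fun j => e (n + 1) j + e n j) z0 zN
    have l2 := sum_mul_rightDiff_nonpos hw hh (e := fun j => e (n + 1) j + e n j) z0 zN
    have : ∑ i ∈ Finset.Icc 1 (N - 1), (e (n + 1) i + e n i) *
          compactOp α p q h (fun j => e (n + 1) j - e n j) i =
        K₁ * τ / 2 * ∑ i ∈ Finset.Icc 1 (N - 1), (e (n + 1) i + e n i) *
          leftDiff α p q h (fun j => e (n + 1) j + e n j) i +
        K₂ * τ / 2 * ∑ i ∈ Finset.Icc 1 (N - 1), (e (n + 1) i + e n i) *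
          rightDiff α p q h N (fun j => e (n + 1) j + e n j) i +
        τ * ∑ i ∈ Finset.Icc 1 (N - 1), r n i * (e (n + 1) i + e n i) := by
      rw [Finset.mul_sum, Finset.mul_sum, Finset.mul_sum, ← Finset.sum_add_distrib,
        ← Finset.sum_add_distrib]
      refine Finset.sum_congr rfl fun i hi => ?_
      rw [Finset.mem_Icc] at hi
      rw [hstep n hn i hi.1 (by omega)]
      ring
    rw [this]
    have m1 : 0 ≤ K₁ * τ / 2 := by positivity
    have m2 : 0 ≤ K₂ * τ / 2 := by positivity
    nlinarith [mul_nonneg m1 (neg_nonneg.2 l1), mul_nonneg m2 (neg_nonneg.2 l2)]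
  have hgrow : ∀ n ≤ M, Real.sqrt (energy c N (e n) (e n)) ≤
      n * (τ * (Real.sqrt N * ρ / Real.sqrt (1 - 4 * c))) := by
    intro n
    induction n with
    | zero =>
      intro _
      have : energy c N (e 0) (e 0) ≤ 0 := by
        refine (energy_le hc N (e 0)).trans (le_of_eq (Finset.sum_eq_zero fun i hi => ?_))
        rw [Finset.mem_Icc] at hi
        rw [hinit i (by omega)]; norm_num
      rw [Real.sqrt_eq_zero'.2 this]; simp
    | succ n ih =>
      intro hn
      have h1 := sqrt_energy_step hc hc' hτ hN (hleft n (by omega)) (hright n (by omega))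
        (hleft (n + 1) hn) (hright (n + 1) hn) (hstep' n hn)
      have h2 : τ * (Real.sqrt (∑ i ∈ Finset.Icc 1 (N - 1), r n i ^ 2) / Real.sqrt (1 - 4 * c)) ≤
          τ * (Real.sqrt N * ρ / Real.sqrt (1 - 4 * c)) := by
        have := hres n hn
        gcongr
      have h3 := ih (by omega)
      push_cast
      linarith
  have hA : Real.sqrt (∑ i ∈ Finset.Icc 1 (N - 1), e n i ^ 2) ≤
      Real.sqrt (energy c N (e n) (e n)) / Real.sqrt (1 - 4 * c) := by
    rw [le_div_iff₀ hsk, ← Real.sqrt_mul (Finset.sum_nonneg fun _ _ => sq_nonneg _), mul_comm]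
    exact Real.sqrt_le_sqrt (le_energy hc hN (hleft n hn) (hright n hn))
  have hnM : (n : ℝ) * τ ≤ T := by
    rw [← hT, mul_comm]
    exact mul_le_mul_of_nonneg_left (by exact_mod_cast hn) hτ
  unfold discreteNorm
  rw [Real.sqrt_mul hh.le]
  calc Real.sqrt h * Real.sqrt (∑ i ∈ Finset.Icc 1 (N - 1), e n i ^ 2)
      ≤ Real.sqrt h * (n * (τ * (Real.sqrt N * ρ / Real.sqrt (1 - 4 * c))) /
          Real.sqrt (1 - 4 * c)) := by
        have := hgrow n hn
        gcongr
        exact hA.trans (by gcongr)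
    _ = (n * τ) * (Real.sqrt h * Real.sqrt N) * ρ /
          (Real.sqrt (1 - 4 * c) * Real.sqrt (1 - 4 * c)) := by
        field_simp
    _ = (n * τ) * Real.sqrt ℓ * ρ / (1 - 4 * c) := by
        rw [Real.mul_self_sqrt hk.le, ← Real.sqrt_mul hh.le, hℓ]
    _ ≤ T * Real.sqrt ℓ * ρ / (1 - 4 * c) := by gcongr
    _ = _ := by ring

/-! ### Truncated powers and their Laplace inversion formula -/

open MeasureTheory Filter Topology Complex FourierTransform in
/-- The Laplace transform of a power, for a complex parameter. Both sides are analytic on the right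
half-plane and agree on the positive real axis. -/
theorem integral_rpow_mul_cexp_neg {s : ℝ} (hs : 0 < s) {z : ℂ} (hz : 0 < z.re) :
    ∫ t in Ioi (0 : ℝ), ((t ^ (s - 1) : ℝ) : ℂ) * cexp (-(z * t)) =
      Real.Gamma s * z ^ (-(s : ℂ)) := by
  have hmeas : ∀ (r : ℝ) (w : ℂ), AEStronglyMeasurable
      (fun t : ℝ => ((t ^ r : ℝ) : ℂ) * cexp (-(w * t))) (volume.restrict (Ioi 0)) := by
    intro r w
    have : Measurable fun t : ℝ => ((t ^ r : ℝ) : ℂ) * cexp (-(w * t)) := by fun_prop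
    exact this.aestronglyMeasurable
  have hnorm : ∀ (r : ℝ) (w : ℂ) (t : ℝ), 0 < t →
      ‖((t ^ r : ℝ) : ℂ) * cexp (-(w * t))‖ = t ^ r * Real.exp (-(w.re * t)) := by
    intro r w t ht
    rw [norm_mul, Complex.norm_real, Real.norm_of_nonneg (Real.rpow_nonneg ht.le _),
      Complex.norm_exp]
    simp
  have hint : ∀ (r : ℝ) (b : ℝ), -1 < r → 0 < b →
      IntegrableOn (fun t : ℝ => t ^ r * Real.exp (-(b * t))) (Ioi 0) := by
    intro r b hr hb
    have := integrableOn_rpow_mul_exp_neg_mul_rpow hr one_pos hb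
    simpa using this
  have hderiv : ∀ w : ℂ, 0 < w.re → DifferentiableAt ℂ (fun w : ℂ =>
      ∫ t in Ioi (0 : ℝ), ((t ^ (s - 1) : ℝ) : ℂ) * cexp (-(w * t))) w := by
    intro w hw
    have hr : 0 < w.re / 2 := by linarith
    have hball : ∀ x ∈ Metric.ball w (w.re / 2), w.re / 2 ≤ x.re := by
      intro x hx
      have h1 : |(x - w).re| ≤ ‖x - w‖ := Complex.abs_re_le_norm _
      rw [Metric.mem_ball, dist_eq_norm] at hx
      rw [Complex.sub_re] at h1
      have := (abs_le.1 (h1.trans hx.le)).1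
      linarith
    refine (hasDerivAt_integral_of_dominated_loc_of_deriv_le
      (F' := fun w t => ((t ^ (s - 1) : ℝ) : ℂ) * cexp (-(w * t)) * (-t))
      (bound := fun t => t ^ s * Real.exp (-(w.re / 2 * t)))
      (Metric.ball_mem_nhds w hr) (Eventually.of_forall fun x => hmeas _ _) ?_ ?_ ?_
      (hint s _ (by linarith) hr) ?_).2.differentiableAt
    · refine (hint (s - 1) w.re (by linarith) hw).mono' (hmeas _ _) ?_
      refine (ae_restrict_iff' measurableSet_Ioi).2 (Eventually.of_forall fun t ht => ?_)
      exact (hnorm _ _ t ht).le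
    · exact (hmeas _ _).mul (by fun_prop)
    · refine (ae_restrict_iff' measurableSet_Ioi).2 (Eventually.of_forall fun t ht x hx => ?_)
      have ht' : (0 : ℝ) < t := ht
      rw [norm_mul, hnorm _ _ t ht, norm_neg, Complex.norm_real, Real.norm_of_nonneg ht'.le,
        mul_right_comm]
      have e : t ^ s = t ^ (s - 1) * t := by
        rw [← Real.rpow_add_one ht'.ne']; ring_nf
      rw [e]
      have := hball x hx
      gcongr
    · refine Eventually.of_forall fun t x _ => ?_
      have h1 : HasDerivAt (fun x : ℂ => -(x * t)) (-(1 * (t : ℂ))) x :=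
        ((hasDerivAt_id x).mul_const _).neg
      have := (h1.cexp).const_mul ((t ^ (s - 1) : ℝ) : ℂ)
      convert! this using 1
      ring
  have hopen : IsOpen {w : ℂ | 0 < w.re} := isOpen_lt continuous_const Complex.continuous_re
  have hconn : IsPreconnected {w : ℂ | 0 < w.re} := (convex_halfSpace_re_gt 0).isPreconnected
  have hl : AnalyticOnNhd ℂ (fun w : ℂ =>
      ∫ t in Ioi (0 : ℝ), ((t ^ (s - 1) : ℝ) : ℂ) * cexp (-(w * t))) {w : ℂ | 0 < w.re} :=
    DifferentiableOn.analyticOnNhd (fun w hw => (hderiv w hw).differentiableWithinAt) hopen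
  have hr : AnalyticOnNhd ℂ (fun w : ℂ => (Real.Gamma s : ℂ) * w ^ (-(s : ℂ)))
      {w : ℂ | 0 < w.re} := by
    refine DifferentiableOn.analyticOnNhd (fun w hw => ?_) hopen
    refine DifferentiableAt.differentiableWithinAt ?_
    exact (differentiableAt_id.cpow_const (Or.inl hw)).const_mul _
  refine hl.eqOn_of_preconnected_of_frequently_eq hr hconn (z₀ := 1) (by simp) ?_ hz
  have hreal : ∀ x : ℝ, 0 < x →
      ∫ t in Ioi (0 : ℝ), ((t ^ (s - 1) : ℝ) : ℂ) * cexp (-((x : ℂ) * t)) =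
        Real.Gamma s * (x : ℂ) ^ (-(s : ℂ)) := by
    intro x hx
    have := Real.integral_rpow_mul_exp_neg_mul_Ioi hs hx
    rw [show (fun t : ℝ => ((t ^ (s - 1) : ℝ) : ℂ) * cexp (-((x : ℂ) * t))) =
      fun t : ℝ => ((t ^ (s - 1) * Real.exp (-(x * t)) : ℝ) : ℂ) by
        ext t; push_cast; rfl, integral_complex_ofReal, this, one_div, Real.inv_rpow hx.le,
        ← Real.rpow_neg hx.le, Complex.ofReal_mul, Complex.ofReal_cpow hx.le, mul_comm]
    simp
  have ht : Tendsto (fun x : ℝ => (x : ℂ)) (𝓝[≠] 1) (𝓝[≠] 1) := by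
    refine tendsto_nhdsWithin_iff.2 ⟨?_, ?_⟩
    · exact (Complex.continuous_ofReal.tendsto' 1 1 (by simp)).mono_left nhdsWithin_le_nhds
    · filter_upwards [self_mem_nhdsWithin] with x hx
      simpa using hx
  refine ht.frequently (Eventually.frequently ?_)
  filter_upwards [nhdsWithin_le_nhds (lt_mem_nhds one_pos)] with x hx
  exact hreal x hx

/-- The truncated power `y₊^β / Γ(β + 1)`, the kernel of the fractional integral of order
`β + 1`. -/
def truncPow (β y : ℝ) : ℝ := max y 0 ^ β / Real.Gamma (β + 1)

theorem truncPow_of_nonpos {β y : ℝ} (hβ : 0 < β) (hy : y ≤ 0) : truncPow β y = 0 := by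
  simp [truncPow, max_eq_right hy, Real.zero_rpow hβ.ne']

theorem truncPow_of_nonneg {β y : ℝ} (hy : 0 ≤ y) :
    truncPow β y = y ^ β / Real.Gamma (β + 1) := by
  simp [truncPow, max_eq_left hy]

theorem continuous_truncPow {β : ℝ} (hβ : 0 < β) : Continuous (truncPow β) := by
  unfold truncPow
  exact ((continuous_id.max continuous_const).rpow_const fun _ => Or.inr hβ.le).div_const _

/-- The parametrization `ξ ↦ 1 + 2πiξ` of the line `Re z = 1`. -/
def vline (ξ : ℝ) : ℂ := 1 + 2 * Real.pi * ξ * Complex.I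

theorem vline_re (ξ : ℝ) : (vline ξ).re = 1 := by simp [vline]

theorem vline_im (ξ : ℝ) : (vline ξ).im = 2 * Real.pi * ξ := by simp [vline]

theorem vline_ne_zero (ξ : ℝ) : vline ξ ≠ 0 := by
  intro h
  have := vline_re ξ
  simp [h] at this

theorem continuous_vline : Continuous vline := by unfold vline; fun_prop

theorem le_norm_vline (ξ : ℝ) : (1 + ‖ξ‖ ^ 2) ^ (1 / 2 : ℝ) ≤ ‖vline ξ‖ := by
  rw [← Real.sqrt_eq_rpow]
  refine Real.sqrt_le_iff.2 ⟨norm_nonneg _, ?_⟩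
  rw [← Complex.normSq_eq_norm_sq, Complex.normSq_apply, vline_re, vline_im, Real.norm_eq_abs,
    sq_abs]
  have h1 : (1 : ℝ) ≤ (2 * Real.pi) ^ 2 := by nlinarith [Real.pi_gt_three]
  nlinarith [mul_le_mul_of_nonneg_right h1 (sq_nonneg ξ)]

theorem one_le_norm_vline (ξ : ℝ) : 1 ≤ ‖vline ξ‖ := by
  have := Complex.abs_re_le_norm (vline ξ)
  rwa [vline_re, abs_one] at this

open MeasureTheory in
theorem integrable_norm_vline_rpow {s : ℝ} (hs : 1 < s) :
    Integrable fun ξ : ℝ => ‖vline ξ‖ ^ (-s) := by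
  have h1 := integrable_rpow_neg_one_add_norm_sq (E := ℝ) (μ := volume) (r := s) (by simpa)
  refine h1.mono' ?_ (Filter.Eventually.of_forall fun ξ => ?_)
  · refine (Continuous.aestronglyMeasurable ?_)
    exact continuous_vline.norm.rpow_const fun ξ => Or.inl (norm_ne_zero_iff.2 (vline_ne_zero ξ))
  · rw [Real.norm_of_nonneg (by positivity)]
    have h2 : (1 + ‖ξ‖ ^ 2) ^ (-s / 2) = ((1 + ‖ξ‖ ^ 2) ^ (1 / 2 : ℝ)) ^ (-s) := by
      rw [← Real.rpow_mul (by positivity)]; ring_nf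
    rw [h2]
    exact Real.rpow_le_rpow_of_nonpos (by positivity) (le_norm_vline ξ) (by linarith)

theorem continuous_vline_cpow (s : ℂ) : Continuous fun ξ : ℝ => vline ξ ^ s :=
  continuous_vline.cpow continuous_const fun ξ => Or.inl (by rw [vline_re]; exact one_pos)

theorem norm_vline_cpow (s : ℝ) (ξ : ℝ) : ‖vline ξ ^ (s : ℂ)‖ = ‖vline ξ‖ ^ s :=
  Complex.norm_cpow_real _ _

open MeasureTheory in
theorem integrable_vline_cpow {s : ℝ} (hs : 1 < s) :
    Integrable fun ξ : ℝ => vline ξ ^ (-(s : ℂ)) := by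
  refine (integrable_norm_vline_rpow hs).mono' (continuous_vline_cpow _).aestronglyMeasurable ?_
  refine Filter.Eventually.of_forall fun ξ => ?_
  rw [← norm_vline_cpow]
  simp

theorem norm_cexp_vline_mul (ξ y : ℝ) : ‖Complex.exp (vline ξ * y)‖ = Real.exp y := by
  rw [Complex.norm_exp]
  simp [vline_re]

open MeasureTheory in
theorem integrable_cexp_mul_vline_cpow {s : ℝ} (hs : 1 < s) (y : ℝ) :
    Integrable fun ξ : ℝ => Complex.exp (vline ξ * y) * vline ξ ^ (-(s : ℂ)) := by
  refine (integrable_vline_cpow hs).bdd_mul (c := Real.exp y) ?_ ?_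
  · exact (Complex.continuous_exp.comp
      (continuous_vline.mul continuous_const)).aestronglyMeasurable
  · exact Filter.Eventually.of_forall fun ξ => (norm_cexp_vline_mul ξ y).le

open MeasureTheory FourierTransform in
/-- Laplace inversion for the truncated powers. This is the Fourier inversion formula for
`e^(-y) * truncPow β y`. -/
theorem truncPow_eq_integral {β : ℝ} (hβ : 0 < β) (y : ℝ) :
    (truncPow β y : ℂ) =
      ∫ ξ : ℝ, Complex.exp (vline ξ * y) * vline ξ ^ (-((β + 1 : ℝ) : ℂ)) := by
  set F : ℝ → ℂ := fun y => ((truncPow β y * Real.exp (-y) : ℝ) : ℂ) with hF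
  have hFc : Continuous F := by
    have := continuous_truncPow hβ
    fun_prop
  have hG : Real.Gamma (β + 1) ≠ 0 := (Real.Gamma_pos_of_pos (by linarith)).ne'
  have hFi : Integrable F := by
    refine Integrable.ofReal ?_
    have h1 : IntegrableOn (fun y => truncPow β y * Real.exp (-y)) (Ioi 0) := by
      have := (integrableOn_rpow_mul_exp_neg_mul_rpow (p := 1) (s := β) (b := 1) (by linarith)
        one_pos one_pos).div_const (Real.Gamma (β + 1))
      refine IntegrableOn.congr_fun this (fun y hy => ?_) measurableSet_Ioi
      have hy' : (0 : ℝ) < y := hy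
      simp only [Real.rpow_one]
      rw [truncPow_of_nonneg hy'.le]
      ring_nf
    refine (integrableOn_iff_integrable_of_support_subset ?_).1 h1
    intro y hy
    by_contra h
    simp only [mem_Ioi, not_lt] at h
    refine hy ?_
    change truncPow β y * Real.exp (-y) = 0
    rw [truncPow_of_nonpos hβ h, zero_mul]
  have hFF : 𝓕 F = fun ξ : ℝ => vline ξ ^ (-((β + 1 : ℝ) : ℂ)) := by
    ext ξ
    rw [Real.fourier_real_eq_integral_exp_smul]
    have h1 := integral_rpow_mul_cexp_neg (s := β + 1) (by linarith) (z := vline ξ)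
      (by rw [vline_re]; exact one_pos)
    have h2 : ∫ v : ℝ, Complex.exp (↑(-2 * Real.pi * v * ξ) * Complex.I) • F v =
        ∫ v in Ioi (0 : ℝ), Complex.exp (↑(-2 * Real.pi * v * ξ) * Complex.I) • F v := by
      refine (setIntegral_eq_integral_of_forall_compl_eq_zero fun v hv => ?_).symm
      simp only [mem_Ioi, not_lt] at hv
      simp [hF, truncPow_of_nonpos hβ hv]
    rw [h2]
    have h3 : ∀ v ∈ Ioi (0 : ℝ), Complex.exp (↑(-2 * Real.pi * v * ξ) * Complex.I) • F v =
        (1 / Real.Gamma (β + 1) : ℂ) *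
          (((v ^ (β + 1 - 1) : ℝ) : ℂ) * Complex.exp (-(vline ξ * v))) := by
      intro v hv
      have hv' : (0 : ℝ) < v := hv
      have e : Complex.exp (-(vline ξ * v)) =
          Complex.exp (↑(-2 * Real.pi * v * ξ) * Complex.I) * Complex.exp (-v) := by
        rw [← Complex.exp_add]
        congr 1
        simp only [vline]
        push_cast
        ring
      simp only [hF, smul_eq_mul]
      rw [truncPow_of_nonneg hv'.le, e, add_sub_cancel_right]
      push_cast
      ring
    rw [setIntegral_congr_fun measurableSet_Ioi h3, integral_const_mul, h1]
    have : (Real.Gamma (β + 1) : ℂ) ≠ 0 := by exact_mod_cast hG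
    field_simp
  have hFFi : Integrable (𝓕 F) := by
    rw [hFF]
    exact integrable_vline_cpow (by linarith)
  have hinv := congrFun (hFc.fourierInv_fourier_eq hFi hFFi) y
  rw [hFF, Real.fourierInv_eq'] at hinv
  have hy : (truncPow β y : ℂ) = Complex.exp y * F y := by
    simp only [hF]
    push_cast
    rw [mul_left_comm, ← Complex.exp_add]
    simp
  rw [hy, ← hinv, ← integral_const_mul]
  congr 1
  ext ξ
  rw [smul_eq_mul, ← mul_assoc, ← Complex.exp_add]
  congr 2
  simp [vline]
  ring

/-! ### The symbol of the weighted and shifted Grünwald difference -/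

open Filter Topology Asymptotics in
/-- `f w = a + b * w + c * w ^ 2 + O(w ^ 3)` as `w → 0`, `w ≠ 0`. -/
def HasTaylorTwo (f : ℂ → ℂ) (a b c : ℂ) : Prop :=
  (fun w => f w - (a + b * w + c * w ^ 2)) =O[𝓝[≠] 0] fun w => w ^ 3

namespace HasTaylorTwo

open Filter Topology Asymptotics

variable {f g : ℂ → ℂ} {a b c a' b' c' : ℂ}

theorem poly_isBigO_one (a b c : ℂ) :
    (fun w : ℂ => a + b * w + c * w ^ 2) =O[𝓝[≠] 0] fun _ => (1 : ℂ) := by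
  have : Continuous fun w : ℂ => a + b * w + c * w ^ 2 := by fun_prop
  exact ((this.tendsto 0).mono_left nhdsWithin_le_nhds).isBigO_one ℂ

theorem isBigO_one (hf : HasTaylorTwo f a b c) : f =O[𝓝[≠] 0] fun _ => (1 : ℂ) := by
  have h3 : (fun w : ℂ => w ^ 3) =O[𝓝[≠] 0] fun _ => (1 : ℂ) := by
    have : Continuous fun w : ℂ => w ^ 3 := by fun_prop
    exact ((this.tendsto 0).mono_left nhdsWithin_le_nhds).isBigO_one ℂ
  have := (hf.trans h3).add (poly_isBigO_one a b c)
  simpa using this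

theorem congr_coeff (hf : HasTaylorTwo f a b c) (ha : a = a') (hb : b = b') (hc : c = c') :
    HasTaylorTwo f a' b' c' := by subst ha hb hc; exact hf

theorem add (hf : HasTaylorTwo f a b c) (hg : HasTaylorTwo g a' b' c') :
    HasTaylorTwo (fun w => f w + g w) (a + a') (b + b') (c + c') := by
  refine (IsBigO.add hf hg).congr_left fun w => ?_
  ring

theorem const_mul (hf : HasTaylorTwo f a b c) (k : ℂ) :
    HasTaylorTwo (fun w => k * f w) (k * a) (k * b) (k * c) := by
  refine (hf.const_mul_left k).congr_left fun w => ?_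
  ring

theorem const (k : ℂ) : HasTaylorTwo (fun _ => k) k 0 0 := by
  refine (isBigO_zero _ _).congr_left fun w => ?_
  ring

theorem mul (hf : HasTaylorTwo f a b c) (hg : HasTaylorTwo g a' b' c') :
    HasTaylorTwo (fun w => f w * g w) (a * a') (a * b' + b * a') (a * c' + b * b' + c * a') := by
  have h1 : (fun w => (f w - (a + b * w + c * w ^ 2)) * g w) =O[𝓝[≠] 0] fun w => w ^ 3 := by
    simpa using IsBigO.mul hf hg.isBigO_one
  have h2 : (fun w => (a + b * w + c * w ^ 2) * (g w - (a' + b' * w + c' * w ^ 2)))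
      =O[𝓝[≠] 0] fun w => w ^ 3 := by
    simpa using (poly_isBigO_one a b c).mul hg
  have h3 : (fun w => w ^ 3 * ((b * c' + c * b') + c * c' * w + 0 * w ^ 2))
      =O[𝓝[≠] 0] fun w : ℂ => w ^ 3 := by
    simpa using (isBigO_refl (fun w : ℂ => w ^ 3) (𝓝[≠] 0)).mul
      (poly_isBigO_one (b * c' + c * b') (c * c') 0)
  refine ((h1.add h2).add h3).congr_left fun w => ?_
  ring

theorem exp_mul (k : ℂ) : HasTaylorTwo (fun w => Complex.exp (k * w)) 1 k (k ^ 2 / 2) := by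
  have h := Complex.exp_sub_sum_range_isBigO_pow 3
  have ht : Tendsto (fun w : ℂ => k * w) (𝓝[≠] 0) (𝓝 0) := by
    have : Continuous fun w : ℂ => k * w := by fun_prop
    exact (this.tendsto' 0 0 (by simp)).mono_left nhdsWithin_le_nhds
  have h1 := h.comp_tendsto ht
  have h2 : ((fun x : ℂ => x ^ 3) ∘ fun w => k * w) =O[𝓝[≠] 0] fun w : ℂ => w ^ 3 := by
    refine (isBigO_const_mul_self (k ^ 3) (fun w : ℂ => w ^ 3) _).congr_left fun w => ?_
    simp [mul_pow]
  refine (h1.trans h2).congr_left fun w => ?_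
  simp [Finset.sum_range_succ]
  ring

theorem one_sub_exp_div :
    HasTaylorTwo (fun w => (1 - Complex.exp (-w)) / w) 1 (-1 / 2) (1 / 6) := by
  have h := Complex.exp_sub_sum_range_isBigO_pow 4
  have ht : Tendsto (fun w : ℂ => -w) (𝓝[≠] 0) (𝓝 0) :=
    (continuous_neg.tendsto' 0 0 (by simp)).mono_left nhdsWithin_le_nhds
  have h1 := (h.comp_tendsto ht).mul (isBigO_refl (fun w : ℂ => -w⁻¹) (𝓝[≠] 0))
  have hne : ∀ᶠ w : ℂ in 𝓝[≠] 0, w ≠ 0 := self_mem_nhdsWithin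
  refine (h1.congr' ?_ (EventuallyEq.refl _ _)).trans (IsBigO.of_bound 1 ?_)
  · filter_upwards [hne] with w hw
    simp [Finset.sum_range_succ, Nat.factorial]
    field_simp
    ring
  · filter_upwards [hne] with w hw
    have : ‖w‖ ≠ 0 := norm_ne_zero_iff.2 hw
    simp only [Function.comp_apply, norm_mul, norm_pow, norm_neg, norm_inv]
    field_simp
    rfl

theorem cpow (hf : HasTaylorTwo f 1 b c) (α : ℂ) :
    HasTaylorTwo (fun w => f w ^ α) 1 (α * b) (α * c + α * (α - 1) / 2 * b ^ 2) := by
  have hρ : HasTaylorTwo (fun w => f w + -1) 0 b c := by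
    simpa using hf.add (const (-1))
  have hw : (fun w : ℂ => w ^ 3) =O[𝓝[≠] 0] fun w : ℂ => w := by
    have h1 : (fun w : ℂ => w ^ 2) =O[𝓝[≠] 0] fun _ => (1 : ℂ) := by
      simpa using poly_isBigO_one 0 0 1
    refine (h1.mul (isBigO_refl (fun w : ℂ => w) (𝓝[≠] 0))).congr ?_ ?_ <;> intro w <;> ring
  have hρ1 : (fun w => f w + -1) =O[𝓝[≠] 0] fun w : ℂ => w := by
    have h1 : (fun w : ℂ => (b + c * w + 0 * w ^ 2) * w) =O[𝓝[≠] 0] fun w : ℂ => w := by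
      simpa using (poly_isBigO_one b c 0).mul (isBigO_refl (fun w : ℂ => w) (𝓝[≠] 0))
    refine ((hρ.trans hw).add h1).congr_left fun w => ?_
    ring
  have hρ0 : Tendsto (fun w => f w + -1) (𝓝[≠] 0) (𝓝 0) :=
    hρ1.trans_tendsto (tendsto_id.mono_left nhdsWithin_le_nhds)
  have hb := (Complex.one_add_cpow_hasFPowerSeriesAt_zero (a := α)).isBigO_sub_partialSum_pow 3
  have h1 := (hb.comp_tendsto hρ0).trans (((hρ1.norm_left).norm_right.pow 3).congr_left
    (fun w => rfl))
  have h2 : (fun w => f w ^ α - (1 + α * (f w + -1) +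
      α * (α - 1) / 2 * ((f w + -1) * (f w + -1)))) =O[𝓝[≠] 0] fun w : ℂ => w ^ 3 := by
    refine IsBigO.of_norm_right ((h1.congr_left fun w => ?_).congr_right fun w => by simp)
    simp only [Function.comp_apply, FormalMultilinearSeries.partialSum, Finset.sum_range_succ,
      Finset.sum_range_zero, binomialSeries_apply, Ring.choose_zero_right, Ring.choose_one_right]
    have e2 : Ring.choose α 2 = α * (α - 1) / 2 := by
      simp [Ring.choose_eq_smul, descPochhammer_succ_right, Polynomial.smeval_mul,
        Polynomial.smeval_sub, Polynomial.smeval_X]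
      ring
    rw [e2]
    simp
  have h3 := (const 1).add ((hρ.const_mul α).add ((hρ.mul hρ).const_mul (α * (α - 1) / 2)))
  refine (h2.add h3).congr_left fun w => ?_
  ring

end HasTaylorTwo

/-- The symbol of the weighted and shifted Grünwald difference with shifts `1` and `1 - m`,
divided by the symbol `z ^ α` of the fractional derivative, as a function of `w = z * h`. -/
def symbol (α : ℝ) (m : ℕ) (w : ℂ) : ℂ :=
  ((1 - Complex.exp (-w)) / w) ^ (α : ℂ) *
    (mu₁ α 1 (1 - m) * Complex.exp w + mu₂ α 1 (1 - m) * Complex.exp ((1 - m) * w))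

/-- The difference of the symbols of the compact operator and of the difference operator. -/
def symbolError (α : ℝ) (m : ℕ) (w : ℂ) : ℂ :=
  1 + compactCoeff α 1 (1 - m) * (Complex.exp w - 2 + Complex.exp (-w)) - symbol α m w

/-- The weights `mu₁`, `mu₂` cancel the term of order one of the symbol, and `compactCoeff`
the one of order two. -/
theorem hasTaylorTwo_symbolError (α : ℝ) {m : ℕ} (hm : m ≠ 0) :
    HasTaylorTwo (symbolError α m) 0 0 0 := by
  have hm' : (m : ℂ) ≠ 0 := by exact_mod_cast hm
  have h1 := HasTaylorTwo.one_sub_exp_div.cpow (α : ℂ)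
  have h2 := ((HasTaylorTwo.exp_mul 1).const_mul (mu₁ α 1 (1 - m))).add
    ((HasTaylorTwo.exp_mul (1 - m)).const_mul (mu₂ α 1 (1 - m)))
  have h3 := (((HasTaylorTwo.exp_mul 1).add (HasTaylorTwo.const (-2))).add
    (HasTaylorTwo.exp_mul (-1))).const_mul (compactCoeff α 1 (1 - m))
  have h4 := ((HasTaylorTwo.const 1).add h3).add ((h1.mul h2).const_mul (-1))
  have h5 : symbolError α m = fun w => 1 + (compactCoeff α 1 (1 - m) : ℂ) *
      (Complex.exp (1 * w) + -2 + Complex.exp (-1 * w)) + -1 *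
        (((1 - Complex.exp (-w)) / w) ^ (α : ℂ) * (mu₁ α 1 (1 - m) * Complex.exp (1 * w) +
          mu₂ α 1 (1 - m) * Complex.exp ((1 - m) * w))) := by
    ext w
    simp only [symbolError, symbol, one_mul, neg_one_mul]
    ring
  rw [h5]
  refine h4.congr_coeff ?_ ?_ ?_ <;>
  · simp only [compactCoeff, mu₁, mu₂, shiftCoeff₂]
    push_cast
    simp only [sub_sub_cancel]
    field_simp
    ring

theorem norm_one_sub_exp_neg_le {w : ℂ} (hw : 0 < w.re) : ‖1 - Complex.exp (-w)‖ ≤ 2 := by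
  have h1 : ‖Complex.exp (-w)‖ ≤ 1 := by
    rw [Complex.norm_exp, Complex.neg_re]
    exact Real.exp_le_one_iff.2 (by linarith)
  calc _ ≤ ‖(1 : ℂ)‖ + ‖Complex.exp (-w)‖ := norm_sub_le _ _
    _ ≤ 1 + 1 := by rw [norm_one]; gcongr
    _ = 2 := by norm_num

theorem norm_exp_one_sub_mul_le {H : ℝ} (m : ℕ) {w : ℂ} (hw : 0 < w.re) (hH : w.re ≤ H) :
    ‖Complex.exp ((1 - m) * w)‖ ≤ Real.exp H := by
  rw [Complex.norm_exp]
  refine Real.exp_le_exp.2 ?_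
  have : ((1 - m) * w : ℂ).re = w.re - m * w.re := by
    rw [sub_mul, one_mul, Complex.sub_re, ← Complex.ofReal_natCast, Complex.re_ofReal_mul]
  rw [this]
  have : 0 ≤ (m : ℝ) * w.re := by positivity
  linarith

/-- The symbol error is `O(|w|^3)` in the whole strip `0 < Re w ≤ H`: near the origin by the Taylor
expansion, elsewhere because the symbol is bounded away from the origin. -/
theorem exists_symbolError_le {α : ℝ} (hα : 0 < α) {m : ℕ} (hm : m ≠ 0) (H : ℝ) :
    ∃ C, 0 ≤ C ∧ ∀ w : ℂ, 0 < w.re → w.re ≤ H → ‖symbolError α m w‖ ≤ C * ‖w‖ ^ 3 := by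
  obtain ⟨C₀, hC₀⟩ := (hasTaylorTwo_symbolError α hm).bound
  obtain ⟨δ, hδ, hball⟩ := Metric.mem_nhdsWithin_iff.1 hC₀
  set K : ℝ := 1 + |compactCoeff α 1 (1 - m)| * (Real.exp H + 2 + 1) +
    (2 / δ) ^ α * (|mu₁ α 1 (1 - m)| * Real.exp H + |mu₂ α 1 (1 - m)| * Real.exp H) with hK
  have hK0 : 0 ≤ K := by positivity
  refine ⟨max C₀ 0 + K / δ ^ 3, by positivity, fun w hw hH => ?_⟩
  have hw0 : w ≠ 0 := by rintro rfl; simp at hw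
  by_cases hlt : ‖w‖ < δ
  · have := hball ⟨by simpa using hlt, hw0⟩
    simp only [mem_ofPred_eq, norm_pow, zero_mul, add_zero, sub_zero] at this
    refine this.trans ?_
    gcongr
    exact (le_max_left _ _).trans (le_add_of_nonneg_right (by positivity))
  · rw [not_lt] at hlt
    have e1 : ‖Complex.exp w‖ ≤ Real.exp H := by
      rw [Complex.norm_exp]; exact Real.exp_le_exp.2 hH
    have e2 : ‖Complex.exp (-w)‖ ≤ 1 := by
      rw [Complex.norm_exp, Complex.neg_re]
      exact Real.exp_le_one_iff.2 (by linarith)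
    have e3 := norm_exp_one_sub_mul_le m hw hH
    have e4 : ‖((1 - Complex.exp (-w)) / w) ^ (α : ℂ)‖ ≤ (2 / δ) ^ α := by
      rw [Complex.norm_cpow_real, norm_div]
      have := norm_one_sub_exp_neg_le hw
      gcongr
    have h1 : ‖symbolError α m w‖ ≤ K := by
      unfold symbolError symbol
      refine (norm_sub_le _ _).trans (add_le_add ((norm_add_le _ _).trans ?_) ?_)
      · rw [norm_one, norm_mul, Complex.norm_real, Real.norm_eq_abs]
        gcongr
        refine (norm_add_le _ _).trans (add_le_add ((norm_sub_le _ _).trans ?_) e2)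
        gcongr
        simp
      · rw [norm_mul]
        gcongr
        refine (norm_add_le _ _).trans ?_
        rw [norm_mul, norm_mul, Complex.norm_real, Complex.norm_real, Real.norm_eq_abs,
          Real.norm_eq_abs]
        gcongr
    have h2 : K ≤ K / δ ^ 3 * ‖w‖ ^ 3 := by
      rw [div_mul_eq_mul_div, le_div_iff₀ (by positivity)]
      gcongr
    have h3 : 0 ≤ max C₀ 0 * ‖w‖ ^ 3 := by positivity
    linarith

/-! ### The kernel of the consistency error -/

/-- The binomial series, in terms of the Grünwald weights. -/
theorem hasSum_grunwald_mul_pow (α : ℝ) {x : ℂ} (hx : ‖x‖ < 1) :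
    HasSum (fun k => (grunwald α k : ℂ) * x ^ k) ((1 - x) ^ (α : ℂ)) := by
  have := (Complex.one_add_cpow_hasFPowerSeriesOnBall_zero (a := (α : ℂ))).hasSum (y := -x)
    (by simpa [← ENNReal.ofReal_one, Metric.eball_ofReal] using hx)
  rw [zero_add, ← sub_eq_add_neg] at this
  have h2 : ∀ k, Ring.choose (α : ℂ) k = ((Ring.choose α k : ℝ) : ℂ) := fun k =>
    (Ring.map_choose Complex.ofRealHom α k).symm
  convert! this using 2 with k
  rw [binomialSeries_apply, h2]
  simp [grunwald, neg_pow x]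
  ring

theorem hasSum_weight_mul_pow (α : ℝ) (m : ℕ) {x : ℂ} (hx : ‖x‖ < 1) :
    HasSum (fun k => (weight α 1 (1 - m) k : ℂ) * x ^ k)
      ((1 - x) ^ (α : ℂ) * (mu₁ α 1 (1 - m) + mu₂ α 1 (1 - m) * x ^ m)) := by
  have h1 := hasSum_grunwald_mul_pow α hx
  have h2 : HasSum (fun k => (shiftedGrunwald α m k : ℂ) * x ^ k) (x ^ m * (1 - x) ^ (α : ℂ)) := by
    have h3 := h1.mul_left (x ^ m)
    rw [← hasSum_nat_add_iff' m]
    rw [Finset.sum_eq_zero, sub_zero]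
    · convert! h3 using 2 with k
      rw [shiftedGrunwald_add, pow_add]
      ring
    · intro k hk
      simp [shiftedGrunwald_of_lt (Finset.mem_range.1 hk)]
  have h4 := (h1.mul_left (mu₁ α 1 (1 - m) : ℂ)).add (h2.mul_left (mu₂ α 1 (1 - m) : ℂ))
  convert! h4 using 1
  · ext k
    rw [weight_eq]
    push_cast
    ring
  · ring

/-- The consistency error of the compact difference operator at `y`, for the truncated power
`truncPow 6`, whose fractional derivative of order `α` is `truncPow (6 - α)`. -/
def kernelError (α : ℝ) (m : ℕ) (h : ℝ) (n : ℕ) (y : ℝ) : ℝ :=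
  truncPow (6 - α) y + compactCoeff α 1 (1 - m) * (truncPow (6 - α) (y - h) -
    2 * truncPow (6 - α) y + truncPow (6 - α) (y + h)) -
  1 / h ^ α * ∑ k ∈ Finset.range (n + 2), weight α 1 (1 - m) k * truncPow 6 (y - (k - 1) * h)

theorem abs_weight_le {α : ℝ} (h1 : 1 < α) (h2 : α < 2) (m k : ℕ) :
    |weight α 1 (1 - m) k| ≤ 2 * (|mu₁ α 1 (1 - m)| + |mu₂ α 1 (1 - m)|) := by
  rw [weight_eq]
  refine (abs_add_le _ _).trans ?_
  rw [abs_mul, abs_mul]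
  have e1 := abs_grunwald_le h1 h2 k
  have e2 := abs_shiftedGrunwald_le h1 h2 m k
  nlinarith [abs_nonneg (mu₁ α 1 (1 - m)), abs_nonneg (mu₂ α 1 (1 - m)),
    mul_le_mul_of_nonneg_left e1 (abs_nonneg (mu₁ α 1 (1 - m))),
    mul_le_mul_of_nonneg_left e2 (abs_nonneg (mu₂ α 1 (1 - m)))]

theorem norm_exp_neg_lt_one {w : ℂ} (hw : 0 < w.re) : ‖Complex.exp (-w)‖ < 1 := by
  rw [Complex.norm_exp, Complex.neg_re]
  exact Real.exp_lt_one_iff.2 (by linarith)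

/-- Principal powers of quotients are quotients of principal powers in the right half-plane. -/
theorem div_cpow_of_re_pos {a w : ℂ} (ha : 0 < a.re) (hw : 0 < w.re) (s : ℂ) :
    (a / w) ^ s = a ^ s / w ^ s := by
  have ha0 : a ≠ 0 := by rintro rfl; simp at ha
  have hw0 : w ≠ 0 := by rintro rfl; simp at hw
  have e1 := abs_lt.1 (Complex.abs_arg_lt_pi_div_two_iff.2 (Or.inl ha))
  have e2 := abs_lt.1 (Complex.abs_arg_lt_pi_div_two_iff.2 (Or.inl hw))
  have hlog : Complex.log (a / w) = Complex.log a - Complex.log w := by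
    rw [← Complex.log_exp (x := Complex.log a - Complex.log w), Complex.exp_sub,
      Complex.exp_log ha0, Complex.exp_log hw0]
    · rw [Complex.sub_im, Complex.log_im, Complex.log_im]; linarith
    · rw [Complex.sub_im, Complex.log_im, Complex.log_im]; linarith
  rw [Complex.cpow_def_of_ne_zero (div_ne_zero ha0 hw0), Complex.cpow_def_of_ne_zero ha0,
    Complex.cpow_def_of_ne_zero hw0, ← Complex.exp_sub, hlog, sub_mul]

theorem mul_ofReal_cpow_of_re_pos {z : ℂ} (hz : 0 < z.re) {h : ℝ} (hh : 0 < h) (s : ℂ) :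
    (z * h) ^ s = z ^ s * (h : ℂ) ^ s := by
  have hi : (0 : ℝ) < ((h⁻¹ : ℝ) : ℂ).re := by simpa using hh
  have := div_cpow_of_re_pos hz hi s
  rw [show z / ((h⁻¹ : ℝ) : ℂ) = z * h by push_cast; rw [div_inv_eq_mul]] at this
  rw [this, Complex.ofReal_inv, Complex.inv_cpow, div_inv_eq_mul]
  rw [Complex.arg_ofReal_of_nonneg hh.le]
  exact Real.pi_pos.ne

/-- The series of the weights along the line `Re z = 1` is the symbol. -/
theorem hasSum_weight_mul_exp {α : ℝ} (m : ℕ) {h : ℝ} (hh : 0 < h) (ξ : ℝ) :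
    HasSum (fun k : ℕ => (1 / h ^ α : ℝ) *
      ((weight α 1 (1 - m) k : ℂ) * Complex.exp (-(vline ξ * ((k - 1) * h)))))
      (vline ξ ^ (α : ℂ) * symbol α m (vline ξ * h)) := by
  set w : ℂ := vline ξ * h with hw
  have hzre : 0 < (vline ξ).re := by rw [vline_re]; exact one_pos
  have hwre : 0 < w.re := by rw [hw, Complex.re_mul_ofReal, vline_re]; linarith
  have hlt := norm_exp_neg_lt_one hwre
  have hre : 0 < (1 - Complex.exp (-w)).re := by
    have := (abs_le.1 (Complex.abs_re_le_norm (Complex.exp (-w)))).2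
    rw [Complex.sub_re, Complex.one_re]
    linarith
  have hs := ((hasSum_weight_mul_pow α m hlt).mul_left (Complex.exp w)).mul_left
    ((1 / h ^ α : ℝ) : ℂ)
  convert! hs using 1
  · ext k
    rw [mul_left_comm (Complex.exp w), ← Complex.exp_nat_mul, ← Complex.exp_add]
    congr 3
    rw [hw]
    ring
  · have hh' : ((h ^ α : ℝ) : ℂ) ≠ 0 := by
      exact_mod_cast (Real.rpow_pos_of_pos hh α).ne'
    have hz' : vline ξ ^ (α : ℂ) ≠ 0 := by
      rw [Ne, Complex.cpow_eq_zero_iff]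
      exact fun h => vline_ne_zero ξ h.1
    rw [symbol, div_cpow_of_re_pos hre hwre, hw, mul_ofReal_cpow_of_re_pos hzre hh,
      ← Complex.ofReal_cpow hh.le, ← hw, Complex.ofReal_div, Complex.ofReal_one,
      show ((1 : ℂ) - m) * w = w + m * -w by ring, Complex.exp_add, Complex.exp_nat_mul]
    field_simp

theorem vline_cpow_mul_cpow (s t ξ : ℝ) :
    vline ξ ^ (-(s : ℂ)) * vline ξ ^ (t : ℂ) = vline ξ ^ (-((s - t : ℝ) : ℂ)) := by
  rw [← Complex.cpow_add _ _ (vline_ne_zero ξ)]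
  congr 1
  push_cast
  ring

open MeasureTheory in
/-- The Laplace representation of the difference operator applied to a truncated power. -/
theorem sum_weight_truncPow_eq_integral {α : ℝ} (h1 : 1 < α) (h2 : α < 2) (m : ℕ) {h : ℝ}
    (hh : 0 < h) {n : ℕ} {y : ℝ} (hy : y ≤ n * h) :
    ((1 / h ^ α * ∑ k ∈ Finset.range (n + 2),
      weight α 1 (1 - m) k * truncPow 6 (y - (k - 1) * h) : ℝ) : ℂ) =
    ∫ ξ : ℝ, Complex.exp (vline ξ * y) * vline ξ ^ (-((7 - α : ℝ) : ℂ)) *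
      symbol α m (vline ξ * h) := by
  set G : ℕ → ℝ → ℂ := fun k ξ => ((1 / h ^ α * weight α 1 (1 - m) k : ℝ) : ℂ) *
    (Complex.exp (vline ξ * ((y - (k - 1) * h : ℝ) : ℂ)) * vline ξ ^ (-((7 : ℝ) : ℂ))) with hG
  have hGint : ∀ k, Integrable (G k) := fun k =>
    (integrable_cexp_mul_vline_cpow (by norm_num) _).const_mul _
  have hGval : ∀ k, ∫ ξ, G k ξ =
      ((1 / h ^ α * weight α 1 (1 - m) k * truncPow 6 (y - (k - 1) * h) : ℝ) : ℂ) := by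
    intro k
    simp only [hG]
    rw [integral_const_mul, Complex.ofReal_mul _ (truncPow _ _), truncPow_eq_integral (by norm_num)]
    norm_num
  have hGnorm : ∀ k ξ, ‖G k ξ‖ =
      |1 / h ^ α * weight α 1 (1 - m) k| * Real.exp (y - (k - 1) * h) * ‖vline ξ‖ ^ (-7 : ℝ) := by
    intro k ξ
    simp only [hG]
    rw [norm_mul, norm_mul, norm_cexp_vline_mul, Complex.norm_real, Real.norm_eq_abs,
      ← norm_vline_cpow, mul_assoc]
    simp
  have hGsum : Summable fun k => ∫ ξ, ‖G k ξ‖ := by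
    simp only [hGnorm, integral_const_mul]
    refine Summable.mul_right _ ?_
    have hgeo : Summable fun k : ℕ => |1 / h ^ α| * (2 * (|mu₁ α 1 (1 - m)| + |mu₂ α 1 (1 - m)|)) *
        Real.exp (y + h) * Real.exp (-h) ^ k :=
      (summable_geometric_of_lt_one (Real.exp_pos _).le
        (Real.exp_lt_one_iff.2 (by linarith))).mul_left _
    refine Summable.of_nonneg_of_le (fun k => by positivity) (fun k => ?_) hgeo
    rw [abs_mul, mul_assoc (|1 / h ^ α| * _) (Real.exp _), ← Real.exp_nat_mul, ← Real.exp_add]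
    have := abs_weight_le h1 h2 m k
    rw [show y - (k - 1) * h = y + h + k * -h by ring]
    gcongr
  have hmain := hasSum_integral_of_summable_integral_norm hGint hGsum
  have hfin : HasSum (fun k => ∫ ξ, G k ξ) ((1 / h ^ α * ∑ k ∈ Finset.range (n + 2),
      weight α 1 (1 - m) k * truncPow 6 (y - (k - 1) * h) : ℝ) : ℂ) := by
    have : ((1 / h ^ α * ∑ k ∈ Finset.range (n + 2),
        weight α 1 (1 - m) k * truncPow 6 (y - (k - 1) * h) : ℝ) : ℂ) =
        ∑ k ∈ Finset.range (n + 2), ∫ ξ, G k ξ := by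
      simp only [hGval, Finset.mul_sum, mul_assoc]
      push_cast
      rfl
    rw [this]
    refine hasSum_sum_of_ne_finset_zero fun k hk => ?_
    rw [hGval, truncPow_of_nonpos (by norm_num), mul_zero, Complex.ofReal_zero]
    rw [Finset.mem_range, not_lt] at hk
    have : ((n + 2 : ℕ) : ℝ) ≤ k := by exact_mod_cast hk
    push_cast at this
    nlinarith
  rw [hfin.unique hmain]
  congr 1
  ext ξ
  have hs := (hasSum_weight_mul_exp (α := α) m hh ξ).mul_left
    (Complex.exp (vline ξ * y) * vline ξ ^ (-((7 : ℝ) : ℂ)))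
  rw [← vline_cpow_mul_cpow 7 α ξ]
  rw [show Complex.exp (vline ξ * y) * (vline ξ ^ (-((7 : ℝ) : ℂ)) * vline ξ ^ (α : ℂ)) *
    symbol α m (vline ξ * h) = Complex.exp (vline ξ * y) * vline ξ ^ (-((7 : ℝ) : ℂ)) *
      (vline ξ ^ (α : ℂ) * symbol α m (vline ξ * h)) by ring, ← hs.tsum_eq]
  refine tsum_congr fun k => ?_
  simp only [hG]
  rw [show vline ξ * ((y - (k - 1) * h : ℝ) : ℂ) = vline ξ * y + -(vline ξ * ((k - 1) * h)) by
    push_cast; ring, Complex.exp_add]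
  push_cast
  ring

theorem norm_symbol_le (α : ℝ) (hα : 0 < α) (m : ℕ) {h : ℝ} (hh : 0 < h) (ξ : ℝ) :
    ‖symbol α m (vline ξ * h)‖ ≤
      (2 / h) ^ α * (|mu₁ α 1 (1 - m)| * Real.exp h + |mu₂ α 1 (1 - m)| * Real.exp h) := by
  have hre : (vline ξ * h).re = h := by rw [Complex.re_mul_ofReal, vline_re, one_mul]
  have hw : 0 < (vline ξ * h).re := by rw [hre]; exact hh
  have hnw : h ≤ ‖vline ξ * h‖ := by
    rw [norm_mul, Complex.norm_real, Real.norm_of_nonneg hh.le]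
    nlinarith [one_le_norm_vline ξ]
  have e1 := norm_one_sub_exp_neg_le hw
  have e3 := norm_exp_one_sub_mul_le m hw hre.le
  have e2 : ‖Complex.exp (vline ξ * h)‖ ≤ Real.exp h := by rw [Complex.norm_exp, hre]
  rw [symbol, norm_mul, Complex.norm_cpow_real, norm_div]
  gcongr
  refine (norm_add_le _ _).trans ?_
  rw [norm_mul, norm_mul, Complex.norm_real, Complex.norm_real, Real.norm_eq_abs,
    Real.norm_eq_abs]
  gcongr

open MeasureTheory in
theorem integral_second_diff {A B C D : ℝ → ℂ} (c : ℂ) (hA : Integrable A) (hB : Integrable B)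
    (hC : Integrable C) (hD : Integrable D) :
    ∫ x, (A x + c * (B x - 2 * A x + C x) - D x) =
      (∫ x, A x) + c * ((∫ x, B x) - 2 * (∫ x, A x) + (∫ x, C x)) - (∫ x, D x) := by
  have h1 : Integrable fun x => B x - 2 * A x := hB.sub (hA.const_mul 2)
  have h2 : Integrable fun x => B x - 2 * A x + C x := h1.add hC
  have h3 : Integrable fun x => c * (B x - 2 * A x + C x) := h2.const_mul c
  have h4 : Integrable fun x => A x + c * (B x - 2 * A x + C x) := hA.add h3
  rw [integral_sub h4 hD, integral_add hA h3, integral_const_mul, integral_add h1 hC,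
    integral_sub hB (hA.const_mul 2), integral_const_mul]

open MeasureTheory in
/-- The Laplace representation of the kernel. The finite sum in `kernelError` may be replaced by the
whole series of weights as long as `y ≤ n * h`, where the remaining truncated powers vanish. -/
theorem kernelError_eq_integral {α : ℝ} (h1 : 1 < α) (h2 : α < 2) (m : ℕ) {h : ℝ}
    (hh : 0 < h) {n : ℕ} {y : ℝ} (hy : y ≤ n * h) :
    (kernelError α m h n y : ℂ) =
      ∫ ξ : ℝ, Complex.exp (vline ξ * y) * vline ξ ^ (-((7 - α : ℝ) : ℂ)) *
        symbolError α m (vline ξ * h) := by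
  have hr : (6 - α + 1 : ℝ) = 7 - α := by ring
  have hT : ∀ d : ℝ, (truncPow (6 - α) (y + d) : ℂ) =
      ∫ ξ : ℝ, Complex.exp (vline ξ * y) * vline ξ ^ (-((7 - α : ℝ) : ℂ)) *
        Complex.exp (vline ξ * d) := by
    intro d
    rw [truncPow_eq_integral (by linarith), hr]
    congr 1
    ext ξ
    rw [Complex.ofReal_add, mul_add, Complex.exp_add]
    ring
  have hI : ∀ d : ℝ, Integrable fun ξ : ℝ => Complex.exp (vline ξ * y) *
      vline ξ ^ (-((7 - α : ℝ) : ℂ)) * Complex.exp (vline ξ * d) := by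
    intro d
    refine (integrable_cexp_mul_vline_cpow (by linarith : 1 < 7 - α) (y + d)).congr
      (Filter.Eventually.of_forall fun ξ => ?_)
    simp only [Complex.ofReal_add, mul_add, Complex.exp_add]
    ring
  have hS : Integrable fun ξ : ℝ => Complex.exp (vline ξ * y) *
      vline ξ ^ (-((7 - α : ℝ) : ℂ)) * symbol α m (vline ξ * h) := by
    refine (integrable_cexp_mul_vline_cpow (by linarith : 1 < 7 - α) y).mul_bdd
      (c := (2 / h) ^ α * (|mu₁ α 1 (1 - m)| * Real.exp h + |mu₂ α 1 (1 - m)| * Real.exp h)) ?_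
      (Filter.Eventually.of_forall fun ξ => norm_symbol_le α (by linarith) m hh ξ)
    have h3 := continuous_vline.measurable
    have : Measurable fun ξ : ℝ => symbol α m (vline ξ * h) := by
      unfold symbol
      fun_prop
    exact this.aestronglyMeasurable
  unfold kernelError
  rw [Complex.ofReal_sub, sum_weight_truncPow_eq_integral h1 h2 m hh hy]
  have t0 := hT 0
  have i0 := hI 0
  simp only [add_zero, Complex.ofReal_zero, mul_zero, Complex.exp_zero, mul_one] at t0 i0
  have t1 := hT (-h)
  have t2 := hT h
  rw [← sub_eq_add_neg] at t1
  push_cast at t0 t1 t2 ⊢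
  push_cast at hS i0
  have i1 := hI (-h)
  have i2 := hI h
  push_cast at i1 i2
  rw [t0, t1, t2, ← integral_second_diff _ i0 i1 i2 hS]
  congr 1
  ext ξ
  simp only [symbolError]
  rw [mul_neg]
  ring

/-- The kernel of the consistency error is of order `h ^ 3` on bounded intervals. -/
theorem exists_kernelError_le {α : ℝ} (h1 : 1 < α) (h2 : α < 2) {m : ℕ} (hm : m ≠ 0) (H : ℝ) :
    ∃ C, 0 ≤ C ∧ ∀ (h : ℝ) (n : ℕ) (y : ℝ), 0 < h → h ≤ H → y ≤ n * h →
      |kernelError α m h n y| ≤ C * h ^ 3 * Real.exp y := by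
  obtain ⟨C, hC, hb⟩ := exists_symbolError_le (by linarith : 0 < α) hm H
  refine ⟨C * ∫ ξ : ℝ, ‖vline ξ‖ ^ (-(4 - α)), ?_, fun h n y hh hH hy => ?_⟩
  · exact mul_nonneg hC (MeasureTheory.integral_nonneg fun ξ => by positivity)
  · rw [← Real.norm_eq_abs, ← Complex.norm_real, kernelError_eq_integral h1 h2 m hh hy]
    have hi := (integrable_norm_vline_rpow (s := 4 - α) (by linarith)).const_mul
      (C * h ^ 3 * Real.exp y)
    refine (MeasureTheory.norm_integral_le_of_norm_le hi
      (Filter.Eventually.of_forall fun ξ => ?_)).trans (le_of_eq ?_)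
    · rw [norm_mul, norm_mul, norm_cexp_vline_mul]
      have hre : (vline ξ * h).re = h := by
        rw [Complex.re_mul_ofReal, vline_re, one_mul]
      have hw := hb (vline ξ * h) (by rw [hre]; exact hh) (by rw [hre]; exact hH)
      rw [norm_mul, Complex.norm_real, Real.norm_of_nonneg hh.le] at hw
      have hz : ‖vline ξ ^ (-((7 - α : ℝ) : ℂ))‖ = ‖vline ξ‖ ^ (-(7 - α)) := by
        rw [← norm_vline_cpow]; simp
      have hpos : 0 < ‖vline ξ‖ := norm_pos_iff.2 (vline_ne_zero ξ)
      have hp : ‖vline ξ‖ ^ (-(4 - α)) = ‖vline ξ‖ ^ (-(7 - α)) * ‖vline ξ‖ ^ 3 := by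
        rw [← Real.rpow_natCast, ← Real.rpow_add hpos]
        congr 1
        push_cast
        ring
      rw [hz, hp]
      calc _ ≤ Real.exp y * ‖vline ξ‖ ^ (-(7 - α)) * (C * (‖vline ξ‖ * h) ^ 3) := by gcongr
        _ = _ := by ring
    · rw [MeasureTheory.integral_const_mul]
      ring

/-! ### Fractional integrals of smooth functions which vanish on the left -/

theorem hasDerivAt_truncPow_of_pos {β y : ℝ} (hβ : -1 < β) (hy : 0 < y) :
    HasDerivAt (truncPow (β + 1)) (truncPow β y) y := by
  have h1 : HasDerivAt (fun y : ℝ => y ^ (β + 1) / Real.Gamma (β + 1 + 1))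
      ((β + 1) * y ^ (β + 1 - 1) / Real.Gamma (β + 1 + 1)) y :=
    (Real.hasDerivAt_rpow_const (Or.inl hy.ne')).div_const _
  have h2 : truncPow (β + 1) =ᶠ[nhds y] fun y : ℝ => y ^ (β + 1) / Real.Gamma (β + 1 + 1) := by
    filter_upwards [lt_mem_nhds hy] with x hx
    exact truncPow_of_nonneg hx.le
  refine (h1.congr_of_eventuallyEq h2).congr_deriv ?_
  have h3 : β + 1 ≠ 0 := by linarith
  have h4 : Real.Gamma (β + 1) ≠ 0 := (Real.Gamma_pos_of_pos (by linarith)).ne'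
  rw [truncPow_of_nonneg hy.le, Real.Gamma_add_one h3, add_sub_cancel_right]
  field_simp

theorem hasDerivAt_truncPow {β : ℝ} (hβ : 0 < β) (y : ℝ) :
    HasDerivAt (truncPow (β + 1)) (truncPow β y) y := by
  rcases lt_trichotomy y 0 with hy | rfl | hy
  · rw [truncPow_of_nonpos hβ hy.le]
    refine (hasDerivAt_const y (0 : ℝ)).congr_of_eventuallyEq ?_
    filter_upwards [gt_mem_nhds hy] with x hx
    exact truncPow_of_nonpos (by linarith) hx.le
  · have h0 : truncPow β 0 = 0 := truncPow_of_nonpos hβ le_rfl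
    rw [h0, ← hasDerivWithinAt_univ, ← Iic_union_Ici (a := (0 : ℝ))]
    refine HasDerivWithinAt.union ?_ ?_
    · refine (hasDerivWithinAt_const (0 : ℝ) _ (0 : ℝ)).congr (fun x hx => ?_) ?_
      · exact truncPow_of_nonpos (by linarith) hx
      · exact truncPow_of_nonpos (by linarith) le_rfl
    · have h1 : HasDerivAt (fun y : ℝ => y ^ (β + 1) / Real.Gamma (β + 1 + 1))
          ((β + 1) * 0 ^ (β + 1 - 1) / Real.Gamma (β + 1 + 1)) 0 :=
        (Real.hasDerivAt_rpow_const (Or.inr (by linarith))).div_const _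
      rw [add_sub_cancel_right, Real.zero_rpow hβ.ne', mul_zero, zero_div] at h1
      exact h1.hasDerivWithinAt.congr (fun x hx => truncPow_of_nonneg hx)
        (truncPow_of_nonneg le_rfl)
  · exact hasDerivAt_truncPow_of_pos (by linarith) hy

theorem truncPow_nonneg {β : ℝ} (hβ : -1 < β) (y : ℝ) : 0 ≤ truncPow β y :=
  div_nonneg (Real.rpow_nonneg (le_max_right _ _) _) (Real.Gamma_nonneg_of_nonneg (by linarith))

theorem truncPow_mono {β : ℝ} (hβ : 0 ≤ β) : Monotone (truncPow β) := by
  intro x y hxy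
  have := Real.Gamma_nonneg_of_nonneg (by linarith : 0 ≤ β + 1)
  unfold truncPow
  gcongr

theorem intervalIntegrable_truncPow_sub {β : ℝ} (hβ : -1 < β) {a x : ℝ} (hx : a ≤ x) :
    IntervalIntegrable (fun s => truncPow β (x - s)) MeasureTheory.volume a x := by
  have h1 : IntervalIntegrable (fun s : ℝ => (x - s) ^ β / Real.Gamma (β + 1))
      MeasureTheory.volume a x := by
    have := ((intervalIntegral.intervalIntegrable_rpow' hβ (a := x - a) (b := 0)).comp_sub_left
      x).div_const (Real.Gamma (β + 1))
    simpa using this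
  refine h1.congr fun s hs => ?_
  rw [uIoc_of_le hx] at hs
  exact (truncPow_of_nonneg (by linarith [hs.2])).symm

/-- Integration by parts against a truncated power. -/
theorem integral_truncPow_mul_eq {β : ℝ} (hβ : -1 < β) {a x : ℝ} (hx : a ≤ x) {g g' : ℝ → ℝ}
    (hg : ∀ s, HasDerivAt g (g' s) s) (hg' : Continuous g') (ha : g a = 0) :
    ∫ s in a..x, truncPow β (x - s) * g s = ∫ s in a..x, truncPow (β + 1) (x - s) * g' s := by
  have hgc : Continuous g := continuous_iff_continuousAt.2 fun s => (hg s).continuousAt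
  have hV : Continuous fun s => -truncPow (β + 1) (x - s) := by
    have := continuous_truncPow (by linarith : 0 < β + 1)
    fun_prop
  have h := intervalIntegral.integral_mul_deriv_eq_deriv_mul_of_hasDerivAt (a := a) (b := x)
    (u := g) (u' := g') (v := fun s => -truncPow (β + 1) (x - s))
    (v' := fun s => truncPow β (x - s)) hgc.continuousOn hV.continuousOn (fun s _ => hg s)
    (fun s hs => ?_) (hg'.intervalIntegrable _ _) (intervalIntegrable_truncPow_sub hβ hx)
  · rw [ha, sub_self, truncPow_of_nonpos (by linarith) le_rfl] at h
    simp only [mul_comm (truncPow _ _)]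
    rw [h]
    simp
  · rw [max_eq_right hx] at hs
    have h1 := hasDerivAt_truncPow_of_pos hβ (by linarith [hs.2] : 0 < x - s)
    have h2 := (h1.comp s ((hasDerivAt_id s).const_sub x)).neg
    simpa using! h2

section vanishing

variable {a : ℝ} {g : ℝ → ℝ} {n : ℕ}

theorem hasDerivAt_iteratedDeriv (hg : ContDiff ℝ n g) {k : ℕ} (hk : k < n) (x : ℝ) :
    HasDerivAt (iteratedDeriv k g) (iteratedDeriv (k + 1) g x) x := by
  rw [iteratedDeriv_succ]
  exact ((hg.differentiable_iteratedDeriv k (by exact_mod_cast hk)) x).hasDerivAt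

theorem continuous_iteratedDeriv' (hg : ContDiff ℝ n g) {k : ℕ} (hk : k ≤ n) :
    Continuous (iteratedDeriv k g) :=
  hg.continuous_iteratedDeriv k (by exact_mod_cast hk)

theorem iteratedDeriv_eq_zero_of_vanishing (hg : ContDiff ℝ n g) (h0 : ∀ x < a, g x = 0) {k : ℕ}
    (hk : k ≤ n) : iteratedDeriv k g a = 0 := by
  have h1 : ∀ x < a, iteratedDeriv k g x = 0 := by
    intro x hx
    have : g =ᶠ[nhds x] fun _ => 0 := by
      filter_upwards [gt_mem_nhds hx] with y hy
      exact h0 y hy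
    rw [this.iteratedDeriv_eq k]
    simp
  have h2 : a ∈ closure (Iio a) := by rw [closure_Iio]; exact self_mem_Iic
  have h3 : IsClosed {x | iteratedDeriv k g x = 0} :=
    isClosed_eq (continuous_iteratedDeriv' hg hk) continuous_const
  exact closure_minimal (fun x hx => h1 x hx) h3 h2

/-- Moving `k` derivatives from the density into the order of a fractional integral. -/
theorem integral_truncPow_mul_iteratedDeriv (hg : ContDiff ℝ n g) (h0 : ∀ x < a, g x = 0) {β : ℝ}
    (hβ : -1 < β) {x : ℝ} (hx : a ≤ x) (j k : ℕ) (hk : j + k ≤ n) :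
    ∫ s in a..x, truncPow β (x - s) * iteratedDeriv j g s =
      ∫ s in a..x, truncPow (β + k) (x - s) * iteratedDeriv (j + k) g s := by
  induction k with
  | zero => simp
  | succ k ih =>
    rw [ih (by omega), integral_truncPow_mul_eq (by linarith [Nat.cast_nonneg (α := ℝ) k]) hx
      (fun s => hasDerivAt_iteratedDeriv hg (by omega) s)
      (continuous_iteratedDeriv' hg (by omega))
      (iteratedDeriv_eq_zero_of_vanishing hg h0 (by omega))]
    push_cast
    rw [add_assoc β]
    rfl

theorem integral_truncPow_extend {β : ℝ} (hβ : 0 < β) {x b : ℝ} (hb : x ≤ b)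
    {F : ℝ → ℝ} (hF : Continuous F) :
    ∫ s in a..x, truncPow β (x - s) * F s = ∫ s in a..b, truncPow β (x - s) * F s := by
  have hc : Continuous fun s => truncPow β (x - s) * F s := by
    have := continuous_truncPow hβ
    fun_prop
  rw [← intervalIntegral.integral_add_adjacent_intervals (hc.intervalIntegrable a x)
    (hc.intervalIntegrable x b)]
  rw [left_eq_add]
  refine (intervalIntegral.integral_congr (g := fun _ => 0) fun s hs => ?_).trans (by simp)
  rw [uIcc_of_le hb] at hs
  simp only
  rw [truncPow_of_nonpos hβ (by linarith [hs.1]), zero_mul]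

/-- Taylor's formula with integral remainder, for a function which vanishes to the left of `a`. -/
theorem eq_integral_truncPow (hg : ContDiff ℝ (7 : ℕ) g) (h0 : ∀ x < a, g x = 0) {x b : ℝ}
    (hab : a ≤ b) (hb : x ≤ b) :
    g x = ∫ s in a..b, truncPow 6 (x - s) * iteratedDeriv 7 g s := by
  rcases lt_or_ge x a with hx | hx
  · rw [h0 x hx]
    refine ((intervalIntegral.integral_congr (g := fun _ => 0) fun s hs => ?_).trans
      (by simp)).symm
    rw [uIcc_of_le hab] at hs
    simp only
    rw [truncPow_of_nonpos (by norm_num) (by linarith [hs.1]), zero_mul]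
  · rw [← integral_truncPow_extend (by norm_num) hb (continuous_iteratedDeriv' hg le_rfl)]
    have h1 := integral_truncPow_mul_iteratedDeriv hg h0 (β := 0) (by norm_num) hx 1 6 (by norm_num)
    norm_num at h1
    rw [← h1]
    have h2 : ∀ s, truncPow 0 (x - s) * deriv g s = deriv g s := by
      intro s
      simp [truncPow]
    simp only [h2]
    have h3 := continuous_iteratedDeriv' hg (show 1 ≤ 7 by norm_num)
    rw [iteratedDeriv_one] at h3
    rw [intervalIntegral.integral_deriv_eq_sub (fun s _ =>
      hg.differentiable (by norm_num) s) (h3.intervalIntegrable _ _)]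
    have h4 := iteratedDeriv_eq_zero_of_vanishing hg h0 (Nat.zero_le 7)
    rw [iteratedDeriv_zero] at h4
    rw [h4, sub_zero]

/-- Differentiation of a fractional integral with respect to its upper limit. -/
theorem hasDerivAt_integral_truncPow {β : ℝ} (hβ : 0 < β) {b : ℝ} {F : ℝ → ℝ}
    (hF : Continuous F) (x : ℝ) :
    HasDerivAt (fun y => ∫ s in a..b, truncPow (β + 1) (y - s) * F s)
      (∫ s in a..b, truncPow β (x - s) * F s) x := by
  have hc : ∀ γ : ℝ, 0 < γ → ∀ y : ℝ, Continuous fun s => truncPow γ (y - s) * F s := by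
    intro γ hγ y
    have := continuous_truncPow hγ
    fun_prop
  have hb : Continuous fun s => truncPow β (x + 1 - s) * |F s| := by
    have := continuous_truncPow hβ
    fun_prop
  refine (intervalIntegral.hasDerivAt_integral_of_dominated_loc_of_deriv_le
    (F' := fun y s => truncPow β (y - s) * F s)
    (bound := fun s => truncPow β (x + 1 - s) * |F s|)
    (Metric.ball_mem_nhds x one_pos)
    (Filter.Eventually.of_forall fun y => (hc _ (by linarith) y).aestronglyMeasurable)
    ((hc _ (by linarith) x).intervalIntegrable _ _)
    (hc _ hβ x).aestronglyMeasurable ?_ (hb.intervalIntegrable _ _) ?_).2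
  · refine Filter.Eventually.of_forall fun s _ y hy => ?_
    rw [Metric.mem_ball, Real.dist_eq, abs_lt] at hy
    rw [norm_mul, Real.norm_of_nonneg (truncPow_nonneg (by linarith) _), Real.norm_eq_abs]
    exact mul_le_mul_of_nonneg_right (truncPow_mono hβ.le (by linarith [hy.2])) (abs_nonneg _)
  · refine Filter.Eventually.of_forall fun s _ y _ => ?_
    have h1 := hasDerivAt_truncPow hβ (y - s)
    have h2 := (h1.comp y ((hasDerivAt_id y).sub_const s)).mul_const (F s)
    simpa using! h2

end vanishing

/-! ### The fractional derivative of a smooth function which vanishes on the left -/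

/-- The left Riemann-Liouville derivative of order `α` of a `C^7` function which vanishes to the
left of `a`, as a fractional integral of order `7 - α`. The upper limit `b` is harmless since the
kernel vanishes for `s ≥ x`; this expression also makes sense at the end points. -/
def fracDeriv (a b α : ℝ) (g : ℝ → ℝ) (x : ℝ) : ℝ :=
  ∫ s in a..b, truncPow (6 - α) (x - s) * iteratedDeriv 7 g s

theorem leftRL_eq_fracDeriv {a b α : ℝ} (h1 : 1 < α) (h2 : α < 2) {g f : ℝ → ℝ}
    (hg : ContDiff ℝ (7 : ℕ) g) (h0 : ∀ x < a, g x = 0) (hf : ∀ x ∈ Icc a b, f x = g x) {x : ℝ}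
    (hx : x ∈ Ioo a b) : leftRL a α f x = fracDeriv a b α g x := by
  have hceil : ⌈α⌉₊ = 2 := by
    rw [Nat.ceil_eq_iff (by norm_num)]
    norm_num
    exact ⟨h1, h2.le⟩
  have hΓ : Real.Gamma (2 - α) ≠ 0 := (Real.Gamma_pos_of_pos (by linarith)).ne'
  have hc7 : Continuous (iteratedDeriv 7 g) := continuous_iteratedDeriv' hg le_rfl
  unfold leftRL fracDeriv
  rw [hceil, if_neg (by push_cast; exact h2.ne)]
  have hev : (fun y => ∫ ξ in a..y, f ξ / (y - ξ) ^ (α - ((2 : ℕ) : ℝ) + 1)) =ᶠ[nhds x]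
      fun y => Real.Gamma (2 - α) *
        ∫ s in a..b, truncPow (6 - α + 1 + 1) (y - s) * iteratedDeriv 7 g s := by
    filter_upwards [Ioo_mem_nhds hx.1 hx.2] with y hy
    have e1 := integral_truncPow_mul_iteratedDeriv hg h0 (β := 1 - α) (by linarith) hy.1.le 0 7
      (by norm_num)
    rw [zero_add, iteratedDeriv_zero, integral_truncPow_extend (by push_cast; linarith)
      hy.2.le hc7] at e1
    rw [show (1 : ℝ) - α + (7 : ℕ) = 6 - α + 1 + 1 by push_cast; ring] at e1
    rw [← e1, ← intervalIntegral.integral_const_mul]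
    refine intervalIntegral.integral_congr fun s hs => ?_
    rw [uIcc_of_le hy.1.le] at hs
    rw [hf s ⟨hs.1, hs.2.trans hy.2.le⟩, truncPow_of_nonneg (by linarith [hs.2]),
      show 1 - α + 1 = 2 - α by ring, show α - ((2 : ℕ) : ℝ) + 1 = -(1 - α) by push_cast; ring,
      Real.rpow_neg (by linarith [hs.2])]
    rw [div_inv_eq_mul]
    field_simp
  rw [hev.iteratedDeriv_eq]
  rw [iteratedDeriv_succ, iteratedDeriv_one]
  have d1 : deriv (fun y => Real.Gamma (2 - α) *
      ∫ s in a..b, truncPow (6 - α + 1 + 1) (y - s) * iteratedDeriv 7 g s) =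
      fun y => Real.Gamma (2 - α) *
        ∫ s in a..b, truncPow (6 - α + 1) (y - s) * iteratedDeriv 7 g s := by
    ext y
    exact ((hasDerivAt_integral_truncPow (by linarith) hc7 y).const_mul _).deriv
  rw [d1, ((hasDerivAt_integral_truncPow (by linarith) hc7 x).const_mul _).deriv]
  push_cast
  field_simp

theorem continuous_fracDeriv {a b α : ℝ} (h2 : α < 2) {g : ℝ → ℝ} (hg : ContDiff ℝ (7 : ℕ) g) :
    Continuous (fracDeriv a b α g) := by
  have hc7 : Continuous (iteratedDeriv 7 g) := continuous_iteratedDeriv' hg le_rfl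
  have := continuous_truncPow (by linarith : 0 < 6 - α)
  unfold fracDeriv
  refine intervalIntegral.continuous_parametric_intervalIntegral_of_continuous' ?_ a b
  unfold Function.uncurry
  fun_prop

theorem abs_integral_mul_le {a b C D : ℝ} (hab : a ≤ b) {F G : ℝ → ℝ}
    (hF : ∀ s ∈ Icc a b, |F s| ≤ C) (hG : ∀ s ∈ Icc a b, |G s| ≤ D) :
    |∫ s in a..b, F s * G s| ≤ C * D * (b - a) := by
  have := intervalIntegral.norm_integral_le_of_norm_le_const (a := a) (b := b) (C := C * D)
    (f := fun s => F s * G s) fun s hs => by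
      rw [uIoc_of_le hab] at hs
      rw [norm_mul]
      exact mul_le_mul (hF s ⟨hs.1.le, hs.2⟩) (hG s ⟨hs.1.le, hs.2⟩) (norm_nonneg _)
        ((abs_nonneg _).trans (hF s ⟨hs.1.le, hs.2⟩))
  rwa [Real.norm_eq_abs, abs_of_nonneg (sub_nonneg.2 hab)] at this

/-- The fractional derivative is bounded in terms of the fourth derivative alone. -/
theorem abs_fracDeriv_le {a b α : ℝ} (hab : a ≤ b) (h2 : α < 2) {g : ℝ → ℝ}
    (hg : ContDiff ℝ (7 : ℕ) g) (h0 : ∀ x < a, g x = 0) {D : ℝ}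
    (hD : ∀ s ∈ Icc a b, |iteratedDeriv 4 g s| ≤ D) {x : ℝ} (hx : x ∈ Icc a b) :
    |fracDeriv a b α g x| ≤ truncPow (3 - α) (b - a) * D * (b - a) := by
  have hc7 : Continuous (iteratedDeriv 7 g) := continuous_iteratedDeriv' hg le_rfl
  have hc4 : Continuous (iteratedDeriv 4 g) := continuous_iteratedDeriv' hg (by norm_num)
  have e1 := integral_truncPow_mul_iteratedDeriv hg h0 (β := 3 - α) (by linarith) hx.1 4 3
    (by norm_num)
  rw [integral_truncPow_extend (by push_cast; linarith) hx.2 hc7,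
    integral_truncPow_extend (by linarith) hx.2 hc4,
    show (3 : ℝ) - α + (3 : ℕ) = 6 - α by push_cast; ring] at e1
  unfold fracDeriv
  rw [← e1]
  refine abs_integral_mul_le hab (fun s hs => ?_) hD
  rw [abs_of_nonneg (truncPow_nonneg (by linarith) _)]
  exact truncPow_mono (by linarith) (by linarith [hx.2, hs.1])

/-! ### Consistency of the compact difference operator -/

theorem intervalIntegral_second_diff {a b : ℝ} {A B C D : ℝ → ℝ} (c : ℝ)
    (hA : IntervalIntegrable A MeasureTheory.volume a b)
    (hB : IntervalIntegrable B MeasureTheory.volume a b)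
    (hC : IntervalIntegrable C MeasureTheory.volume a b)
    (hD : IntervalIntegrable D MeasureTheory.volume a b) :
    ∫ x in a..b, (A x + c * (B x - 2 * A x + C x) - D x) =
      (∫ x in a..b, A x) + c * ((∫ x in a..b, B x) - 2 * (∫ x in a..b, A x) +
        (∫ x in a..b, C x)) - (∫ x in a..b, D x) := by
  have h1 : IntervalIntegrable (fun x => B x - 2 * A x) MeasureTheory.volume a b :=
    hB.sub (hA.const_mul 2)
  have h2 : IntervalIntegrable (fun x => B x - 2 * A x + C x) MeasureTheory.volume a b := h1.add hC
  have h3 : IntervalIntegrable (fun x => c * (B x - 2 * A x + C x)) MeasureTheory.volume a b :=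
    h2.const_mul c
  have h4 : IntervalIntegrable (fun x => A x + c * (B x - 2 * A x + C x))
    MeasureTheory.volume a b := hA.add h3
  rw [intervalIntegral.integral_sub h4 hD, intervalIntegral.integral_add hA h3,
    intervalIntegral.integral_const_mul, intervalIntegral.integral_add h1 hC,
    intervalIntegral.integral_sub hB (hA.const_mul 2), intervalIntegral.integral_const_mul]

/-- The consistency error is the integral of `kernelError` against the seventh derivative. -/
theorem compactOp_fracDeriv_sub_leftDiff {a b α h : ℝ} (hab : a ≤ b) (h2 : α < 2) (m : ℕ)
    (hh : 0 < h) {N : ℕ} (hN : h * N = b - a) {g : ℝ → ℝ} (hg : ContDiff ℝ (7 : ℕ) g)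
    (h0 : ∀ x < a, g x = 0) {i : ℕ} (hi : 1 ≤ i) (hiN : i < N) :
    compactOp α 1 (1 - m) h (fun j => fracDeriv a b α g (a + j * h)) i -
        leftDiff α 1 (1 - m) h (fun j => g (a + j * h)) i =
      ∫ s in a..b, kernelError α m h i (a + i * h - s) * iteratedDeriv 7 g s := by
  have hc7 : Continuous (iteratedDeriv 7 g) := continuous_iteratedDeriv' hg le_rfl
  have hI : ∀ β : ℝ, 0 < β → ∀ y : ℝ, IntervalIntegrable
      (fun s => truncPow β (y - s) * iteratedDeriv 7 g s) MeasureTheory.volume a b := by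
    intro β hβ y
    have := continuous_truncPow hβ
    exact Continuous.intervalIntegrable (by fun_prop) _ _
  have hα : 0 < 6 - α := by linarith
  have hnode : ∀ k ∈ Finset.range (i + 2), g (a + (i + 1 - k : ℕ) * h) =
      ∫ s in a..b, truncPow 6 (a + i * h - (k - 1) * h - s) * iteratedDeriv 7 g s := by
    intro k hk
    rw [Finset.mem_range] at hk
    have e : a + ((i + 1 - k : ℕ) : ℝ) * h = a + i * h - (k - 1) * h := by
      rw [Nat.cast_sub (by omega)]; push_cast; ring
    rw [e]
    refine eq_integral_truncPow hg h0 hab ?_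
    rw [← e]
    have : ((i + 1 - k : ℕ) : ℝ) ≤ N := by exact_mod_cast (by omega : i + 1 - k ≤ N)
    nlinarith
  have hleft : leftDiff α 1 (1 - m) h (fun j => g (a + j * h)) i =
      ∫ s in a..b, 1 / h ^ α * ∑ k ∈ Finset.range (i + 2), weight α 1 (1 - m) k *
        (truncPow 6 (a + i * h - (k - 1) * h - s) * iteratedDeriv 7 g s) := by
    rw [intervalIntegral.integral_const_mul, intervalIntegral.integral_finsetSum fun k _ =>
      (hI 6 (by norm_num) _).const_mul _]
    unfold leftDiff
    congr 1
    refine Finset.sum_congr rfl fun k hk => ?_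
    simp only
    rw [hnode k hk, intervalIntegral.integral_const_mul]
  have hD : IntervalIntegrable (fun s => 1 / h ^ α * ∑ k ∈ Finset.range (i + 2),
      weight α 1 (1 - m) k * (truncPow 6 (a + i * h - (k - 1) * h - s) * iteratedDeriv 7 g s))
      MeasureTheory.volume a b := by
    have := continuous_truncPow (show (0 : ℝ) < 6 by norm_num)
    exact Continuous.intervalIntegrable (by fun_prop) _ _
  have e1 : a + ((i - 1 : ℕ) : ℝ) * h = a + i * h - h := by
    rw [Nat.cast_sub hi]; push_cast; ring
  have e2 : a + ((i + 1 : ℕ) : ℝ) * h = a + i * h + h := by push_cast; ring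
  rw [compactOp_eq _ _ _ hh.ne', hleft, e1, e2]
  unfold fracDeriv
  rw [← intervalIntegral_second_diff _ (hI _ hα _) (hI _ hα _) (hI _ hα _) hD]
  refine intervalIntegral.integral_congr fun s _ => ?_
  simp only [kernelError]
  rw [show a + i * h - h - s = a + i * h - s - h by ring,
    show a + i * h + h - s = a + i * h - s + h by ring, sub_mul _ _ (iteratedDeriv 7 g s),
    mul_assoc (1 / h ^ α), Finset.sum_mul]
  congr 1
  · ring
  · congr 1
    refine Finset.sum_congr rfl fun k _ => ?_
    rw [sub_right_comm, mul_assoc]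

/-- The compact difference operator is consistent of order three, uniformly in the function
in terms of its seventh derivative. -/
theorem exists_consistency {a b α : ℝ} (hab : a ≤ b) (h1 : 1 < α) (h2 : α < 2) {m : ℕ}
    (hm : m ≠ 0) :
    ∃ C, 0 ≤ C ∧ ∀ (h : ℝ) (N : ℕ) (g : ℝ → ℝ) (D : ℝ), 0 < h → h * N = b - a →
      ContDiff ℝ (7 : ℕ) g → (∀ x < a, g x = 0) → (∀ s ∈ Icc a b, |iteratedDeriv 7 g s| ≤ D) →
      ∀ i, 1 ≤ i → i < N →
        |compactOp α 1 (1 - m) h (fun j => fracDeriv a b α g (a + j * h)) i -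
          leftDiff α 1 (1 - m) h (fun j => g (a + j * h)) i| ≤ C * D * h ^ 3 := by
  obtain ⟨C, hC, hker⟩ := exists_kernelError_le h1 h2 hm (b - a)
  refine ⟨C * Real.exp (b - a) * (b - a), by have := sub_nonneg.2 hab; positivity, ?_⟩
  intro h N g D hh hN hg h0 hD i hi hiN
  rw [compactOp_fracDeriv_sub_leftDiff hab h2 m hh hN hg h0 hi hiN]
  have hNi : ((i : ℕ) : ℝ) ≤ N := by exact_mod_cast hiN.le
  have hN1 : (1 : ℝ) ≤ N := by exact_mod_cast (by omega : 1 ≤ N)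
  refine (abs_integral_mul_le hab (C := C * h ^ 3 * Real.exp (b - a)) (fun s hs => ?_)
    hD).trans (le_of_eq (by ring))
  refine (hker h i (a + i * h - s) hh (by nlinarith) (by linarith [hs.1])).trans ?_
  gcongr
  · nlinarith
  · exact hs.1

/-! ### Reflection of the space interval -/

/-- The right Riemann-Liouville derivative is the left one after the reflection `x ↦ -x`. -/
theorem rightRL_eq_leftRL {b α : ℝ} (h1 : 1 < α) (h2 : α < 2) (f : ℝ → ℝ) (x : ℝ) :
    rightRL b α f x = leftRL (-b) α (fun y => f (-y)) (-x) := by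
  have hceil : ⌈α⌉₊ = 2 := by
    rw [Nat.ceil_eq_iff (by norm_num)]
    norm_num
    exact ⟨h1, h2.le⟩
  unfold rightRL leftRL
  rw [hceil, if_neg (by push_cast; exact h2.ne), if_neg (by push_cast; exact h2.ne)]
  have h : (fun y => ∫ ξ in y..b, f ξ / (ξ - y) ^ (α - ((2 : ℕ) : ℝ) + 1)) =
      fun y => (fun y' => ∫ ξ in -b..y', f (-ξ) / (y' - ξ) ^ (α - ((2 : ℕ) : ℝ) + 1)) (-y) := by
    ext y
    have := intervalIntegral.integral_comp_neg (a := -b) (b := -y)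
      (fun ξ => f ξ / (ξ - y) ^ (α - ((2 : ℕ) : ℝ) + 1))
    rw [neg_neg, neg_neg] at this
    rw [← this]
    refine intervalIntegral.integral_congr fun ξ _ => ?_
    rw [show -ξ - y = -y - ξ by ring]
  have h' := iteratedDeriv_comp_neg 2
    (fun y' => ∫ ξ in -b..y', f (-ξ) / (y' - ξ) ^ (α - ((2 : ℕ) : ℝ) + 1)) x
  rw [h, h']
  norm_num

theorem compactOp_reflect (α : ℝ) (p q : ℤ) (h : ℝ) {N : ℕ} (V : ℕ → ℝ) {i : ℕ} (h1 : 1 ≤ i)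
    (h2 : i < N) :
    compactOp α p q h V i = compactOp α p q h (fun j => V (N - j)) (N - i) := by
  simp only [compactOp, secondDiff]
  rw [show N - (N - i) = i by omega, show N - (N - i - 1) = i + 1 by omega,
    show N - (N - i + 1) = i - 1 by omega]
  ring

/-! ### Linearity of the difference operators -/

section linear

variable (α : ℝ) (p q : ℤ) (h : ℝ) (N : ℕ) (V W : ℕ → ℝ) (k : ℝ) (i : ℕ)

theorem compactOp_sub : compactOp α p q h (fun j => V j - W j) i =
    compactOp α p q h V i - compactOp α p q h W i := by
  unfold compactOp secondDiff; ring

theorem compactOp_const_mul : compactOp α p q h (fun j => k * V j) i =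
    k * compactOp α p q h V i := by
  unfold compactOp secondDiff; ring

theorem leftDiff_add : leftDiff α p q h (fun j => V j + W j) i =
    leftDiff α p q h V i + leftDiff α p q h W i := by
  simp only [leftDiff, mul_add, Finset.sum_add_distrib]

theorem leftDiff_sub : leftDiff α p q h (fun j => V j - W j) i =
    leftDiff α p q h V i - leftDiff α p q h W i := by
  simp only [leftDiff, mul_sub, Finset.sum_sub_distrib]

theorem leftDiff_const_mul : leftDiff α p q h (fun j => k * V j) i =
    k * leftDiff α p q h V i := by
  simp only [leftDiff, mul_left_comm _ k, ← Finset.mul_sum]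

theorem rightDiff_add : rightDiff α p q h N (fun j => V j + W j) i =
    rightDiff α p q h N V i + rightDiff α p q h N W i := by
  simp only [rightDiff, mul_add, Finset.sum_add_distrib]

theorem rightDiff_sub : rightDiff α p q h N (fun j => V j - W j) i =
    rightDiff α p q h N V i - rightDiff α p q h N W i := by
  simp only [rightDiff, mul_sub, Finset.sum_sub_distrib]

variable {V W N i}

theorem compactOp_congr (hi : 1 ≤ i) (hiN : i < N) (hVW : ∀ j ≤ N, V j = W j) :
    compactOp α p q h V i = compactOp α p q h W i := by
  unfold compactOp secondDiff
  rw [hVW i hiN.le, hVW (i - 1) (by omega), hVW (i + 1) hiN]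

theorem abs_compactOp_le {h : ℝ} (hh : h ≠ 0) {B : ℝ} (hi : 1 ≤ i) (hiN : i < N)
    (hV : ∀ j ≤ N, |V j| ≤ B) :
    |compactOp α p q h V i| ≤ (1 + 4 * |compactCoeff α p q|) * B := by
  rw [compactOp_eq α p q hh]
  have e0 := hV i hiN.le
  have e1 := hV (i - 1) (by omega)
  have e2 := hV (i + 1) hiN
  have e3 : |V (i - 1) - 2 * V i + V (i + 1)| ≤ 4 * B := by
    rw [abs_le] at *
    constructor <;> linarith [e0.1, e0.2, e1.1, e1.2, e2.1, e2.2]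
  calc _ ≤ |V i| + |compactCoeff α p q * (V (i - 1) - 2 * V i + V (i + 1))| := abs_add_le _ _
    _ ≤ B + |compactCoeff α p q| * (4 * B) := by
      rw [abs_mul]
      gcongr
    _ = _ := by ring

end linear

/-! ### Partial derivatives and Taylor estimates in time -/

/-- The partial derivative in the first variable. -/
def partialX (v : ℝ × ℝ → ℝ) : ℝ × ℝ → ℝ := fun z => fderiv ℝ v z (1, 0)

/-- The partial derivative in the second variable. -/
def partialT (v : ℝ × ℝ → ℝ) : ℝ × ℝ → ℝ := fun z => fderiv ℝ v z (0, 1)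

theorem contDiff_partialX {v : ℝ × ℝ → ℝ} {n : ℕ} (hv : ContDiff ℝ (n + 1 : ℕ) v) :
    ContDiff ℝ n (partialX v) :=
  (hv.fderiv_right (m := n) (by exact_mod_cast le_rfl)).clm_apply contDiff_const

theorem contDiff_partialT {v : ℝ × ℝ → ℝ} {n : ℕ} (hv : ContDiff ℝ (n + 1 : ℕ) v) :
    ContDiff ℝ n (partialT v) :=
  (hv.fderiv_right (m := n) (by exact_mod_cast le_rfl)).clm_apply contDiff_const

theorem hasDerivAt_partialX {v : ℝ × ℝ → ℝ} {n : ℕ} (hv : ContDiff ℝ (n + 1 : ℕ) v) (x t : ℝ) :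
    HasDerivAt (fun y => v (y, t)) (partialX v (x, t)) x := by
  have h1 : HasFDerivAt v (fderiv ℝ v (x, t)) (x, t) :=
    (hv.differentiable (by simp) (x, t)).hasFDerivAt
  exact h1.comp_hasDerivAt x ((hasDerivAt_id x).prodMk (hasDerivAt_const x t))

theorem hasDerivAt_partialT {v : ℝ × ℝ → ℝ} {n : ℕ} (hv : ContDiff ℝ (n + 1 : ℕ) v) (x t : ℝ) :
    HasDerivAt (fun s => v (x, s)) (partialT v (x, t)) t := by
  have h1 : HasFDerivAt v (fderiv ℝ v (x, t)) (x, t) :=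
    (hv.differentiable (by simp) (x, t)).hasFDerivAt
  exact h1.comp_hasDerivAt t ((hasDerivAt_const t x).prodMk (hasDerivAt_id t))

theorem contDiff_iterate_partialX (k : ℕ) : ∀ {v : ℝ × ℝ → ℝ} {n : ℕ},
    ContDiff ℝ (n + k : ℕ) v → ContDiff ℝ n (partialX^[k] v) := by
  induction k with
  | zero => intro v n hv; exact hv
  | succ k ih =>
    intro v n hv
    rw [Function.iterate_succ_apply]
    exact ih (contDiff_partialX hv)

theorem iteratedDeriv_eq_iterate_partialX (k : ℕ) : ∀ {v : ℝ × ℝ → ℝ} {n : ℕ},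
    ContDiff ℝ (n + k : ℕ) v → ∀ x t,
      iteratedDeriv k (fun y => v (y, t)) x = (partialX^[k] v) (x, t) := by
  induction k with
  | zero => intro v n _ x t; simp
  | succ k ih =>
    intro v n hv x t
    have h1 : deriv (fun y => v (y, t)) = fun y => partialX v (y, t) := by
      ext y
      exact (hasDerivAt_partialX (n := n + k) hv y t).deriv
    rw [iteratedDeriv_succ', h1, Function.iterate_succ_apply]
    exact ih (contDiff_partialX hv) x t

theorem exists_bound_on_box {v : ℝ × ℝ → ℝ} (hv : Continuous v) (a b T : ℝ) :
    ∃ B, 0 ≤ B ∧ ∀ x ∈ Icc a b, ∀ t ∈ Icc 0 T, |v (x, t)| ≤ B := by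
  obtain ⟨B, hB⟩ := (isCompact_Icc.prod isCompact_Icc :
    IsCompact (Icc a b ×ˢ Icc 0 T)).exists_bound_of_continuousOn hv.continuousOn
  exact ⟨max B 0, le_max_right _ _, fun x hx t ht => (hB (x, t) ⟨hx, ht⟩).trans (le_max_left _ _)⟩

theorem abs_second_difference_le {G G' G'' : ℝ → ℝ} {T B s δ : ℝ}
    (h1 : ∀ t, HasDerivAt G (G' t) t) (h2 : ∀ t, HasDerivAt G' (G'' t) t)
    (hB : ∀ t ∈ Icc 0 T, |G'' t| ≤ B) (hδ : 0 ≤ δ) (hl : 0 ≤ s - δ) (hr : s + δ ≤ T) :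
    |G (s + δ) + G (s - δ) - 2 * G s| ≤ 2 * B * δ ^ 2 := by
  have hG' : ∀ r ∈ Icc 0 δ, |G' (s + r) - G' (s - r)| ≤ 2 * B * δ := by
    intro r hr'
    have h3 := (convex_Icc 0 T).norm_image_sub_le_of_norm_hasDerivWithin_le
      (f := G') (f' := G'') (C := B) (fun t _ => (h2 t).hasDerivWithinAt) hB
      (x := s - r) (y := s + r) ⟨by linarith [hr'.1, hr'.2], by linarith [hr'.1, hr'.2]⟩
      ⟨by linarith [hr'.1, hr'.2], by linarith [hr'.1, hr'.2]⟩
    rw [Real.norm_eq_abs, Real.norm_eq_abs, show s + r - (s - r) = 2 * r by ring,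
      abs_of_nonneg (by linarith [hr'.1] : 0 ≤ 2 * r)] at h3
    have hB0 : 0 ≤ B := (abs_nonneg _).trans (hB s ⟨by linarith, by linarith⟩)
    nlinarith [mul_le_mul_of_nonneg_left hr'.2 hB0]
  have h4 := (convex_Icc 0 δ).norm_image_sub_le_of_norm_hasDerivWithin_le
    (f := fun r => G (s + r) + G (s - r)) (f' := fun r => G' (s + r) - G' (s - r))
    (C := 2 * B * δ) (fun r _ => ?_) hG' (x := 0) (y := δ) ⟨le_rfl, hδ⟩ ⟨hδ, le_rfl⟩
  · simp only [add_zero, sub_zero, Real.norm_eq_abs, abs_of_nonneg hδ] at h4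
    rw [show G (s + δ) + G (s - δ) - (G s + G s) = G (s + δ) + G (s - δ) - 2 * G s by ring] at h4
    exact h4.trans (le_of_eq (by ring))
  · have e1 := (h1 (s + r)).comp r ((hasDerivAt_id r).const_add s)
    have e2 := (h1 (s - r)).comp r ((hasDerivAt_id r).const_sub s)
    have e3 := (e1.add e2).hasDerivWithinAt (s := Icc 0 δ)
    simpa [sub_eq_add_neg] using! e3

theorem abs_central_difference_le {G G' G'' G''' : ℝ → ℝ} {T B s δ : ℝ}
    (h1 : ∀ t, HasDerivAt G (G' t) t) (h2 : ∀ t, HasDerivAt G' (G'' t) t)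
    (h3 : ∀ t, HasDerivAt G'' (G''' t) t)
    (hB : ∀ t ∈ Icc 0 T, |G''' t| ≤ B) (hδ : 0 ≤ δ) (hl : 0 ≤ s - δ) (hr : s + δ ≤ T) :
    |G (s + δ) - G (s - δ) - 2 * δ * G' s| ≤ 2 * B * δ ^ 3 := by
  have hB0 : 0 ≤ B := (abs_nonneg _).trans (hB s ⟨by linarith, by linarith⟩)
  have hK : ∀ r ∈ Icc 0 δ, |G' (s + r) + G' (s - r) - 2 * G' s| ≤ 2 * B * δ ^ 2 := by
    intro r hr'
    refine (abs_second_difference_le h2 h3 hB hr'.1 (by linarith [hr'.2])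
      (by linarith [hr'.2])).trans ?_
    have := hr'.1
    have := hr'.2
    gcongr
  have h4 := (convex_Icc 0 δ).norm_image_sub_le_of_norm_hasDerivWithin_le
    (f := fun r => G (s + r) - G (s - r) - 2 * r * G' s)
    (f' := fun r => G' (s + r) + G' (s - r) - 2 * G' s)
    (C := 2 * B * δ ^ 2) (fun r _ => ?_) hK (x := 0) (y := δ) ⟨le_rfl, hδ⟩ ⟨hδ, le_rfl⟩
  · simp only [add_zero, sub_zero, Real.norm_eq_abs, abs_of_nonneg hδ, sub_self, mul_zero,
      zero_mul] at h4
    exact h4.trans (le_of_eq (by ring))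
  · have e1 := (h1 (s + r)).comp r ((hasDerivAt_id r).const_add s)
    have e2 := (h1 (s - r)).comp r ((hasDerivAt_id r).const_sub s)
    have e4 := ((hasDerivAt_id r).const_mul 2).mul_const (G' s)
    have e3 := ((e1.sub e2).sub e4).hasDerivWithinAt (s := Icc 0 δ)
    simpa using! e3

/-! ### The truncation error of the scheme -/

theorem fracDeriv_sub {a b α : ℝ} (h2 : α < 2) {f g : ℝ → ℝ} (hf : ContDiff ℝ (7 : ℕ) f)
    (hg : ContDiff ℝ (7 : ℕ) g) (x : ℝ) :
    fracDeriv a b α (fun y => f y - g y) x = fracDeriv a b α f x - fracDeriv a b α g x := by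
  have hI : ∀ g : ℝ → ℝ, ContDiff ℝ (7 : ℕ) g → IntervalIntegrable
      (fun s => truncPow (6 - α) (x - s) * iteratedDeriv 7 g s) MeasureTheory.volume a b := by
    intro g hg
    have h7 : Continuous (iteratedDeriv 7 g) := continuous_iteratedDeriv' hg le_rfl
    have := continuous_truncPow (by linarith : 0 < 6 - α)
    exact Continuous.intervalIntegrable (by fun_prop) _ _
  unfold fracDeriv
  rw [← intervalIntegral.integral_sub (hI f hf) (hI g hg)]
  refine intervalIntegral.integral_congr fun s _ => ?_
  have : iteratedDeriv 7 (fun y => f y - g y) s = iteratedDeriv 7 f s - iteratedDeriv 7 g s :=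
    iteratedDeriv_fun_sub hf.contDiffAt hg.contDiffAt
  rw [this, mul_sub]

theorem contDiff_slice {v : ℝ × ℝ → ℝ} {n : ℕ} (hv : ContDiff ℝ n v) (t : ℝ) :
    ContDiff ℝ n fun x => v (x, t) :=
  hv.comp (contDiff_id.prodMk contDiff_const)

/-- Consistency in space and time of the compact Crank-Nicolson discretization of the left
fractional derivative. The spatial error is measured on the average of the two time levels, and
the difference between the average and the midpoint on the exact fractional derivative, which only
costs four derivatives in space. -/
theorem exists_left_truncation {a b T α : ℝ} (hab : a ≤ b) (h1 : 1 < α) (h2 : α < 2) {m : ℕ}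
    (hm : m ≠ 0) {v : ℝ × ℝ → ℝ} (hv : ContDiff ℝ (7 : ℕ) v)
    (h0 : ∀ x < a, ∀ t ∈ Icc 0 T, v (x, t) = 0) :
    ∃ C, 0 ≤ C ∧ ∀ (h s δ : ℝ) (N : ℕ), 0 < h → h * N = b - a → 0 ≤ δ → 0 ≤ s - δ → s + δ ≤ T →
      ∀ i, 1 ≤ i → i < N →
        |compactOp α 1 (1 - m) h (fun j => fracDeriv a b α (fun x => v (x, s)) (a + j * h)) i -
          1 / 2 * leftDiff α 1 (1 - m) h
            (fun j => v (a + j * h, s + δ) + v (a + j * h, s - δ)) i| ≤ C * (δ ^ 2 + h ^ 3) := by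
  obtain ⟨C₁, hC₁, hcons⟩ := exists_consistency hab h1 h2 hm
  obtain ⟨B₇, hB₇, hb7⟩ := exists_bound_on_box
    (contDiff_iterate_partialX 7 (n := 0) (by simpa using hv)).continuous a b T
  have hw : ContDiff ℝ (3 : ℕ) (partialX^[4] v) := contDiff_iterate_partialX 4 hv
  obtain ⟨B₄, hB₄, hb4⟩ := exists_bound_on_box
    (contDiff_partialT (n := 1) (contDiff_partialT (n := 2) hw)).continuous a b T
  set c := 1 + 4 * |compactCoeff α 1 (1 - m)| with hc
  have hc0 : 0 ≤ c := by positivity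
  have hP : 0 ≤ truncPow (3 - α) (b - a) := truncPow_nonneg (by linarith) _
  have hba := sub_nonneg.2 hab
  refine ⟨c * (truncPow (3 - α) (b - a) * B₄ * (b - a)) + C₁ * B₇, by positivity, ?_⟩
  intro h s δ N hh hN hδ hl hr i hi hiN
  have hs : s ∈ Icc 0 T := ⟨by linarith, by linarith⟩
  have hsl : s - δ ∈ Icc 0 T := ⟨by linarith, by linarith⟩
  have hsr : s + δ ∈ Icc 0 T := ⟨by linarith, by linarith⟩
  have hsl' := fun t => contDiff_slice hv t
  set g : ℝ → ℝ := fun x => 1 / 2 * (v (x, s + δ) + v (x, s - δ)) with hg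
  have hgC : ContDiff ℝ (7 : ℕ) g := contDiff_const.mul ((hsl' _).add (hsl' _))
  have hit : ∀ (k : ℕ) (n : ℕ), n + k = 7 → ∀ x, iteratedDeriv k g x = 1 / 2 *
      ((partialX^[k] v) (x, s + δ) + (partialX^[k] v) (x, s - δ)) := by
    intro k n hnk x
    have hk : ContDiff ℝ (n + k : ℕ) v := by rw [hnk]; exact hv
    have hk' : ∀ t, ContDiffAt ℝ (k : ℕ) (fun y => v (y, t)) x := fun t =>
      ((hsl' t).of_le (by exact_mod_cast (by omega : k ≤ 7))).contDiffAt
    rw [← iteratedDeriv_eq_iterate_partialX k hk, ← iteratedDeriv_eq_iterate_partialX k hk,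
      ← iteratedDeriv_fun_add (hk' _) (hk' _), ← iteratedDeriv_const_mul_field]
  have hg0 : ∀ x < a, g x = 0 := by
    intro x hx
    simp [hg, h0 x hx _ hsl, h0 x hx _ hsr]
  have hg7 : ∀ x ∈ Icc a b, |iteratedDeriv 7 g x| ≤ B₇ := by
    intro x hx
    rw [hit 7 0 rfl, abs_le]
    have e1 := abs_le.1 (hb7 x hx _ hsl)
    have e2 := abs_le.1 (hb7 x hx _ hsr)
    constructor <;> linarith [e1.1, e1.2, e2.1, e2.2]
  have hmain := hcons h N g B₇ hh hN hgC hg0 hg7 i hi hiN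
  set ψ : ℝ → ℝ := fun x => v (x, s) - g x with hψ
  have hψC : ContDiff ℝ (7 : ℕ) ψ := (hsl' s).sub hgC
  have hψ0 : ∀ x < a, ψ x = 0 := by
    intro x hx
    simp [hψ, h0 x hx _ hs, hg0 x hx]
  have hψ4 : ∀ x ∈ Icc a b, |iteratedDeriv 4 ψ x| ≤ B₄ * δ ^ 2 := by
    intro x hx
    have e0 : iteratedDeriv 4 ψ x = iteratedDeriv 4 (fun y => v (y, s)) x - iteratedDeriv 4 g x :=
      iteratedDeriv_fun_sub ((hsl' s).of_le (by norm_cast)).contDiffAt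
        (hgC.of_le (by norm_cast)).contDiffAt
    have e1 := abs_second_difference_le (G := fun t => (partialX^[4] v) (x, t)) (B := B₄)
      (fun t => hasDerivAt_partialT (n := 2) hw x t)
      (fun t => hasDerivAt_partialT (n := 1) (contDiff_partialT (n := 2) hw) x t)
      (fun t ht => hb4 x hx t ht) hδ hl hr
    rw [e0, hit 4 3 rfl, iteratedDeriv_eq_iterate_partialX 4 (n := 3) hv]
    rw [abs_le] at *
    constructor <;> linarith [e1.1, e1.2]
  have hF : ∀ j ≤ N, |fracDeriv a b α ψ (a + (j : ℕ) * h)| ≤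
      truncPow (3 - α) (b - a) * (B₄ * δ ^ 2) * (b - a) := by
    intro j hj
    have hj' : (j : ℝ) ≤ N := by exact_mod_cast hj
    refine abs_fracDeriv_le hab h2 hψC hψ0 hψ4 ⟨?_, ?_⟩
    · have : 0 ≤ (j : ℝ) * h := by positivity
      linarith
    · nlinarith
  have hcF := abs_compactOp_le α 1 (1 - m) hh.ne' hi hiN hF
  have hsplit : (fun j : ℕ => fracDeriv a b α ψ (a + j * h)) = fun j : ℕ =>
      fracDeriv a b α (fun x => v (x, s)) (a + j * h) - fracDeriv a b α g (a + j * h) := by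
    ext j
    exact fracDeriv_sub h2 (hsl' s) hgC _
  rw [hsplit, compactOp_sub] at hcF
  have hl2 : leftDiff α 1 (1 - m) h (fun j => g (a + j * h)) i = 1 / 2 *
      leftDiff α 1 (1 - m) h (fun j => v (a + j * h, s + δ) + v (a + j * h, s - δ)) i := by
    rw [← leftDiff_const_mul]
  rw [hl2] at hmain
  have hδ2 : 0 ≤ δ ^ 2 := sq_nonneg _
  have hh3 : 0 ≤ h ^ 3 := by positivity
  have n1 : 0 ≤ c * (truncPow (3 - α) (b - a) * B₄ * (b - a)) * h ^ 3 := by positivity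
  have n2 : 0 ≤ C₁ * B₇ * δ ^ 2 := by positivity
  rw [abs_le] at *
  constructor <;> nlinarith [hcF.1, hcF.2, hmain.1, hmain.2]

/-- The analogue of `exists_left_truncation` for the right derivative, by reflection. -/
theorem exists_right_truncation {a b T α : ℝ} (hab : a ≤ b) (h1 : 1 < α) (h2 : α < 2) {m : ℕ}
    (hm : m ≠ 0) {v : ℝ × ℝ → ℝ} (hv : ContDiff ℝ (7 : ℕ) v)
    (h0 : ∀ x > b, ∀ t ∈ Icc 0 T, v (x, t) = 0) :
    ∃ C, 0 ≤ C ∧ ∀ (h s δ : ℝ) (N : ℕ), 0 < h → h * N = b - a → 0 ≤ δ → 0 ≤ s - δ → s + δ ≤ T →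
      ∀ i, 1 ≤ i → i < N →
        |compactOp α 1 (1 - m) h
            (fun j => fracDeriv (-b) (-a) α (fun x => v (-x, s)) (-(a + j * h))) i -
          1 / 2 * rightDiff α 1 (1 - m) h N
            (fun j => v (a + j * h, s + δ) + v (a + j * h, s - δ)) i| ≤ C * (δ ^ 2 + h ^ 3) := by
  have hv' : ContDiff ℝ (7 : ℕ) fun z : ℝ × ℝ => v (-z.1, z.2) :=
    hv.comp (contDiff_fst.neg.prodMk contDiff_snd)
  obtain ⟨C, hC, hb⟩ := exists_left_truncation (T := T) (neg_le_neg hab) h1 h2 hm hv'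
    (fun x hx t ht => h0 (-x) (by linarith) t ht)
  refine ⟨C, hC, fun h s δ N hh hN hδ hl hr i hi hiN => ?_⟩
  have := hb h s δ N hh (by linarith) hδ hl hr (N - i) (by omega) (by omega)
  rw [compactOp_reflect _ _ _ _ _ hi hiN, rightDiff_eq _ _ _ _ _ hi hiN]
  have hnode : ∀ j ≤ N, -(a + ((N - j : ℕ) : ℝ) * h) = -b + j * h := by
    intro j hj
    rw [Nat.cast_sub hj]
    linear_combination -hN
  have e1 : compactOp α 1 (1 - m) h (fun j => fracDeriv (-b) (-a) α (fun x => v (-x, s))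
        (-(a + ((N - j : ℕ) : ℝ) * h))) (N - i) =
      compactOp α 1 (1 - m) h (fun j => fracDeriv (-b) (-a) α (fun x => v (-x, s))
        (-b + j * h)) (N - i) :=
    compactOp_congr _ _ _ _ (N := N) (by omega) (by omega) fun j hj => by rw [hnode j hj]
  have e2 : leftDiff α 1 (1 - m) h (fun j => v (a + ((N - j : ℕ) : ℝ) * h, s + δ) +
        v (a + ((N - j : ℕ) : ℝ) * h, s - δ)) (N - i) =
      leftDiff α 1 (1 - m) h (fun j => v (-(-b + j * h), s + δ) + v (-(-b + j * h), s - δ))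
        (N - i) := by
    unfold leftDiff
    congr 1
    refine Finset.sum_congr rfl fun k hk => ?_
    simp only
    rw [← hnode _ (by omega), neg_neg]
  rw [e1, e2]
  exact this

/-- The differential equation, written in terms of the extension and of integral expressions for the
fractional derivatives, holds up to the end points of the space interval. -/
theorem IsSolution.equation_closed {a b T α K₁ K₂ : ℝ} (hab : a < b) (h1 : 1 < α) (h2 : α < 2)
    {f : ℝ → ℝ → ℝ} {u₀ φa φb : ℝ → ℝ} {u : ℝ → ℝ → ℝ}
    (hf : ContinuousOn (Function.uncurry f) (Icc a b ×ˢ Icc 0 T))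
    (hu : IsSolution a b T α K₁ K₂ f u₀ φa φb u) {v : ℝ × ℝ → ℝ} (hv : ContDiff ℝ (7 : ℕ) v)
    (huv : ∀ x ∈ Icc a b, ∀ t ∈ Icc 0 T, v (x, t) = u x t)
    (hl : K₁ ≠ 0 → ∀ x < a, ∀ t ∈ Icc 0 T, v (x, t) = 0)
    (hr : K₂ ≠ 0 → ∀ x > b, ∀ t ∈ Icc 0 T, v (x, t) = 0) {x t : ℝ} (hx : x ∈ Icc a b)
    (ht : t ∈ Ioc 0 T) :
    f x t = partialT v (x, t) - K₁ * fracDeriv a b α (fun y => v (y, t)) x -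
      K₂ * fracDeriv (-b) (-a) α (fun y => v (-y, t)) (-x) := by
  have htc : t ∈ Icc 0 T := ⟨ht.1.le, ht.2⟩
  have hvt : ContDiff ℝ (7 : ℕ) fun y => v (y, t) := contDiff_slice hv t
  have hvt' : ContDiff ℝ (7 : ℕ) fun y => v (-y, t) := hvt.comp contDiff_neg
  have hopen : EqOn (fun x => f x t) (fun x => partialT v (x, t) -
      K₁ * fracDeriv a b α (fun y => v (y, t)) x -
      K₂ * fracDeriv (-b) (-a) α (fun y => v (-y, t)) (-x)) (Ioo a b) := by
    intro x hx
    have hxc : x ∈ Icc a b := Ioo_subset_Icc_self hx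
    have e1 := hu.equation x hx t ht
    have e2 : HasDerivWithinAt (fun s => u x s) (partialT v (x, t)) (Icc 0 T) t :=
      ((hasDerivAt_partialT (n := 6) hv x t).hasDerivWithinAt).congr
        (fun s hs => (huv x hxc s hs).symm) (huv x hxc t htc).symm
    have e3 := (uniqueDiffOn_Icc (ht.1.trans_le ht.2) t htc).eq_deriv _ e1 e2
    have eL : K₁ * leftRL a α (fun y => u y t) x =
        K₁ * fracDeriv a b α (fun y => v (y, t)) x := by
      by_cases hK : K₁ = 0
      · simp [hK]
      · rw [leftRL_eq_fracDeriv h1 h2 hvt (fun y hy => hl hK y hy t htc)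
          (fun y hy => (huv y hy t htc).symm) hx]
    have eR : K₂ * rightRL b α (fun y => u y t) x =
        K₂ * fracDeriv (-b) (-a) α (fun y => v (-y, t)) (-x) := by
      by_cases hK : K₂ = 0
      · simp [hK]
      · rw [rightRL_eq_leftRL h1 h2, leftRL_eq_fracDeriv (b := -a) h1 h2 hvt'
          (fun y hy => hr hK (-y) (by linarith) t htc)
          (fun y hy => (huv (-y) ⟨by linarith [hy.2], by linarith [hy.1]⟩ t htc).symm)
          ⟨by linarith [hx.2], by linarith [hx.1]⟩]
    simp only
    linarith
  have hcf : ContinuousOn (fun x => f x t) (Icc a b) :=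
    hf.comp (f := fun x : ℝ => (x, t)) (by fun_prop) fun y hy => ⟨hy, htc⟩
  have hcr : Continuous fun x => partialT v (x, t) -
      K₁ * fracDeriv a b α (fun y => v (y, t)) x -
      K₂ * fracDeriv (-b) (-a) α (fun y => v (-y, t)) (-x) := by
    have c1 := (contDiff_partialT (n := 6) hv).continuous
    have c2 := continuous_fracDeriv (a := a) (b := b) h2 hvt
    have c3 := continuous_fracDeriv (a := -b) (b := -a) h2 hvt'
    fun_prop
  exact hopen.of_subset_closure hcf hcr.continuousOn Ioo_subset_Icc_self
    (by rw [closure_Ioo hab.ne]) hx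

/-- The residual of a grid function `V` with respect to the compact Crank-Nicolson scheme with
source term `F`, between two consecutive time levels. -/
def schemeResidual (α K₁ K₂ : ℝ) (p q : ℤ) (h τ : ℝ) (N : ℕ) (V V' F : ℕ → ℝ) (i : ℕ) : ℝ :=
  compactOp α p q h (fun j => τ⁻¹ * (V' j - V j)) i -
    K₁ * (1 / 2 * leftDiff α p q h (fun j => V' j + V j) i) -
    K₂ * (1 / 2 * rightDiff α p q h N (fun j => V' j + V j) i) - compactOp α p q h F i

/-- The truncation error of the scheme at a smooth solution is of order `τ ^ 2 + h ^ 3`. -/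
theorem exists_schemeResidual_le {a b T α K₁ K₂ : ℝ} {m : ℕ} (hab : a < b) (hK₁ : 0 ≤ K₁)
    (hK₂ : 0 ≤ K₂) (h1 : 1 < α) (h2 : α < 2) (hm : m ≠ 0) {f : ℝ → ℝ → ℝ}
    {u₀ φa φb : ℝ → ℝ} {u : ℝ → ℝ → ℝ}
    (hf : ContinuousOn (Function.uncurry f) (Icc a b ×ˢ Icc 0 T))
    (hu : IsSolution a b T α K₁ K₂ f u₀ φa φb u) {v : ℝ × ℝ → ℝ} (hv : ContDiff ℝ (7 : ℕ) v)
    (huv : ∀ x ∈ Icc a b, ∀ t ∈ Icc 0 T, v (x, t) = u x t)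
    (hl : K₁ ≠ 0 → ∀ x < a, ∀ t ∈ Icc 0 T, v (x, t) = 0)
    (hr : K₂ ≠ 0 → ∀ x > b, ∀ t ∈ Icc 0 T, v (x, t) = 0) :
    ∃ C, 0 ≤ C ∧ ∀ (h s δ : ℝ) (N : ℕ), 0 < h → h * N = b - a → 0 < δ → 0 ≤ s - δ → s + δ ≤ T →
      ∀ i, 1 ≤ i → i < N →
        |schemeResidual α K₁ K₂ 1 (1 - m) h (2 * δ) N (fun j => v (a + j * h, s - δ))
          (fun j => v (a + j * h, s + δ)) (fun j => f (a + j * h) s) i| ≤ C * (δ ^ 2 + h ^ 3) := by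
  have hL : ∃ C, 0 ≤ C ∧ ∀ (h s δ : ℝ) (N : ℕ), 0 < h → h * N = b - a → 0 ≤ δ → 0 ≤ s - δ →
      s + δ ≤ T → ∀ i, 1 ≤ i → i < N →
        |K₁ * (compactOp α 1 (1 - m) h
            (fun j => fracDeriv a b α (fun x => v (x, s)) (a + j * h)) i -
          1 / 2 * leftDiff α 1 (1 - m) h
            (fun j => v (a + j * h, s + δ) + v (a + j * h, s - δ)) i)| ≤
          C * (δ ^ 2 + h ^ 3) := by
    by_cases hK : K₁ = 0
    · refine ⟨0, le_rfl, ?_⟩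
      intros
      simp [hK]
    · obtain ⟨C, hC, hb⟩ := exists_left_truncation hab.le h1 h2 hm hv (hl hK)
      refine ⟨K₁ * C, by positivity, fun h s δ N hh hN hδ hl hr i hi hiN => ?_⟩
      rw [abs_mul, abs_of_nonneg hK₁, mul_assoc]
      exact mul_le_mul_of_nonneg_left (hb h s δ N hh hN hδ hl hr i hi hiN) hK₁
  have hR : ∃ C, 0 ≤ C ∧ ∀ (h s δ : ℝ) (N : ℕ), 0 < h → h * N = b - a → 0 ≤ δ → 0 ≤ s - δ →
      s + δ ≤ T → ∀ i, 1 ≤ i → i < N →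
        |K₂ * (compactOp α 1 (1 - m) h
            (fun j => fracDeriv (-b) (-a) α (fun x => v (-x, s)) (-(a + j * h))) i -
          1 / 2 * rightDiff α 1 (1 - m) h N
            (fun j => v (a + j * h, s + δ) + v (a + j * h, s - δ)) i)| ≤
          C * (δ ^ 2 + h ^ 3) := by
    by_cases hK : K₂ = 0
    · refine ⟨0, le_rfl, ?_⟩
      intros
      simp [hK]
    · obtain ⟨C, hC, hb⟩ := exists_right_truncation hab.le h1 h2 hm hv (hr hK)
      refine ⟨K₂ * C, by positivity, fun h s δ N hh hN hδ hl hr i hi hiN => ?_⟩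
      rw [abs_mul, abs_of_nonneg hK₂, mul_assoc]
      exact mul_le_mul_of_nonneg_left (hb h s δ N hh hN hδ hl hr i hi hiN) hK₂
  obtain ⟨CL, hCL, hbL⟩ := hL
  obtain ⟨CR, hCR, hbR⟩ := hR
  have hv1 : ContDiff ℝ (6 : ℕ) (partialT v) := contDiff_partialT hv
  have hv2 : ContDiff ℝ (5 : ℕ) (partialT (partialT v)) := contDiff_partialT hv1
  obtain ⟨B, hB, hbT⟩ := exists_bound_on_box (contDiff_partialT (n := 4) hv2).continuous a b T
  set c := 1 + 4 * |compactCoeff α 1 (1 - m)| with hc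
  have hc0 : 0 ≤ c := by positivity
  refine ⟨c * B + CL + CR, by positivity, ?_⟩
  intro h s δ N hh hN hδ hs0 hsT i hi hiN
  have hnode : ∀ j ≤ N, a + ((j : ℕ) : ℝ) * h ∈ Icc a b := by
    intro j hj
    have hj' : (j : ℝ) ≤ N := by exact_mod_cast hj
    have : 0 ≤ (j : ℝ) * h := by positivity
    exact ⟨by linarith, by nlinarith⟩
  have hF : compactOp α 1 (1 - m) h (fun j => f (a + j * h) s) i =
      compactOp α 1 (1 - m) h (fun j => partialT v (a + j * h, s) -
        K₁ * fracDeriv a b α (fun x => v (x, s)) (a + j * h) -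
        K₂ * fracDeriv (-b) (-a) α (fun x => v (-x, s)) (-(a + j * h))) i :=
    compactOp_congr _ _ _ _ hi hiN fun j hj =>
      hu.equation_closed hab h1 h2 hf hv huv hl hr (hnode j hj) ⟨by linarith, by linarith⟩
  rw [compactOp_sub, compactOp_sub, compactOp_const_mul, compactOp_const_mul] at hF
  have hT : |compactOp α 1 (1 - m) h (fun j => (2 * δ)⁻¹ * (v (a + j * h, s + δ) -
      v (a + j * h, s - δ)) - partialT v (a + j * h, s)) i| ≤ c * (B * δ ^ 2) := by
    refine abs_compactOp_le α 1 (1 - m) hh.ne' hi hiN fun j hj => ?_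
    have := abs_central_difference_le (G := fun t => v (a + j * h, t)) (B := B)
      (fun t => hasDerivAt_partialT (n := 6) hv _ t)
      (fun t => hasDerivAt_partialT (n := 5) hv1 _ t)
      (fun t => hasDerivAt_partialT (n := 4) hv2 _ t)
      (fun t ht => hbT _ (hnode j hj) t ht) hδ.le hs0 hsT
    have e : (2 * δ)⁻¹ * (v (a + j * h, s + δ) - v (a + j * h, s - δ)) -
        partialT v (a + j * h, s) = (2 * δ)⁻¹ * (v (a + j * h, s + δ) - v (a + j * h, s - δ) -
          2 * δ * partialT v (a + j * h, s)) := by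
      field_simp
    rw [e, abs_mul, abs_of_pos (by positivity)]
    calc _ ≤ (2 * δ)⁻¹ * (2 * B * δ ^ 3) := by gcongr
      _ = B * δ ^ 2 := by field_simp
  rw [compactOp_sub] at hT
  have eL := hbL h s δ N hh hN hδ.le hs0 hsT i hi hiN
  have eR := hbR h s δ N hh hN hδ.le hs0 hsT i hi hiN
  have hh3 : 0 ≤ c * B * h ^ 3 := by positivity
  unfold schemeResidual
  rw [hF]
  rw [abs_le] at *
  constructor <;> nlinarith [eL.1, eL.2, eR.1, eR.2, hT.1, hT.2]

/-! ### Convergence -/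

/-- The error of the scheme satisfies the scheme, with the truncation error as right-hand side. -/
theorem IsSchemeSolution.error_step {a b T α K₁ K₂ h τ : ℝ} {p q : ℤ} {N M : ℕ}
    {f : ℝ → ℝ → ℝ} {u₀ φa φb : ℝ → ℝ} {U : ℕ → ℕ → ℝ}
    (hU : IsSchemeSolution a b T α K₁ K₂ f u₀ φa φb p q N M h τ U) (hτ : τ ≠ 0) (V : ℕ → ℕ → ℝ)
    {n : ℕ} (hn : n < M) {i : ℕ} (hi : 1 ≤ i) (hiN : i < N) :
    compactOp α p q h (fun j => (V (n + 1) j - U (n + 1) j) - (V n j - U n j)) i =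
      K₁ * τ / 2 * leftDiff α p q h
        (fun j => (V (n + 1) j - U (n + 1) j) + (V n j - U n j)) i +
      K₂ * τ / 2 * rightDiff α p q h N
        (fun j => (V (n + 1) j - U (n + 1) j) + (V n j - U n j)) i +
      τ * schemeResidual α K₁ K₂ p q h τ N (V n) (V (n + 1))
        (fun j => f (a + j * h) ((n * τ + (n + 1) * τ) / 2)) i := by
  have hs := hU.scheme n hn i hi hiN
  unfold schemeResidual
  simp only [compactOp_sub, compactOp_const_mul, leftDiff_add, leftDiff_sub, rightDiff_add,
    rightDiff_sub]
  have e : τ * (τ⁻¹ * (compactOp α p q h (V (n + 1)) i - compactOp α p q h (V n) i)) =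
      compactOp α p q h (V (n + 1)) i - compactOp α p q h (V n) i := by
    field_simp
  linear_combination -hs - e

end CompactFD

end

theorem theorem2 (a b T α K₁ K₂ : ℝ) (p q : ℤ) (hab : a < b) (hT : 0 < T)
    (hK₁ : 0 ≤ K₁) (hK₂ : 0 ≤ K₂) (hK : K₁ ^ 2 + K₂ ^ 2 ≠ 0)
    (hα : (p = 1 ∧ q = 0 ∧ 1 < α ∧ α < 2) ∨
      (p = 1 ∧ q = -1 ∧ (1 + Real.sqrt 73) / 6 < α ∧ α < 2))
    (f : ℝ → ℝ → ℝ) (u₀ φa φb : ℝ → ℝ) (u : ℝ → ℝ → ℝ)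
    (hφa : K₁ ≠ 0 → ∀ t ∈ Set.Icc 0 T, φa t = 0)
    (hφb : K₂ ≠ 0 → ∀ t ∈ Set.Icc 0 T, φb t = 0)
    (hf : ContinuousOn (Function.uncurry f) (Set.Icc a b ×ˢ Set.Icc 0 T))
    (hu : CompactFD.IsSolution a b T α K₁ K₂ f u₀ φa φb u)
    (hsmooth : CompactFD.SufficientlySmooth a b T K₁ K₂ u) :
    ∃ c : ℝ, 0 < c ∧ ∀ N M : ℕ, 1 ≤ N → 1 ≤ M → ∀ (h τ : ℝ) (U : ℕ → ℕ → ℝ),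
      CompactFD.IsSchemeSolution a b T α K₁ K₂ f u₀ φa φb p q N M h τ U →
      ∀ n, 1 ≤ n → n ≤ M →
        CompactFD.discreteNorm h N (fun i => u (a + i * h) (n * τ) - U n i)
          ≤ c * (τ ^ 2 + h ^ 3) := by
  open CompactFD in
  obtain ⟨h1, h2, hw⟩ := one_lt_and_isDissipative hα
  obtain ⟨hc, hc'⟩ := compactCoeff_bounds hα
  obtain ⟨m, hm, hpq⟩ : ∃ m : ℕ, m ≠ 0 ∧ p = 1 ∧ q = 1 - m := by
    rcases hα with ⟨hp, hq, -, -⟩ | ⟨hp, hq, -, -⟩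
    · exact ⟨1, one_ne_zero, hp, by rw [hq]; norm_num⟩
    · exact ⟨2, two_ne_zero, hp, by rw [hq]; norm_num⟩
  obtain ⟨rfl, rfl⟩ := hpq
  obtain ⟨v, hv, huv, hl, hr⟩ := hsmooth
  obtain ⟨C, hC, hres⟩ := exists_schemeResidual_le hab hK₁ hK₂ h1 h2 hm hf hu
    (by exact_mod_cast hv) huv hl hr
  have hk : 0 < 1 - 4 * compactCoeff α 1 (1 - m) := by linarith
  refine ⟨T * Real.sqrt (b - a) / (1 - 4 * compactCoeff α 1 (1 - m)) * C + 1, by positivity, ?_⟩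
  intro N M hN hM h τ U hU n _ hn
  have hN0 : (0 : ℝ) < N := by exact_mod_cast hN
  have hM0 : (0 : ℝ) < M := by exact_mod_cast hM
  have hhN : h * N = b - a := by rw [hU.space_step]; field_simp
  have hτM : τ * M = T := by rw [hU.time_step]; field_simp
  have hh : 0 < h := by rw [hU.space_step]; exact div_pos (sub_pos.2 hab) hN0
  have hτ : 0 < τ := by rw [hU.time_step]; positivity
  have hxj : ∀ j ≤ N, a + ((j : ℕ) : ℝ) * h ∈ Icc a b := by
    intro j hj
    have hj' : (j : ℝ) ≤ N := by exact_mod_cast hj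
    have : 0 ≤ (j : ℝ) * h := by positivity
    exact ⟨by linarith, by nlinarith⟩
  have htn : ∀ n ≤ M, ((n : ℕ) : ℝ) * τ ∈ Icc 0 T := by
    intro n hn
    have hn' : (n : ℝ) ≤ M := by exact_mod_cast hn
    exact ⟨by positivity, by nlinarith⟩
  -- The error is measured with the extension `v`, which agrees with `u` at all grid points.
  set V : ℕ → ℕ → ℝ := fun n j => v (a + j * h, n * τ) with hV
  have hVu : ∀ n ≤ M, ∀ j ≤ N, V n j = u (a + j * h) (n * τ) := fun n hn j hj =>
    huv _ (hxj j hj) _ (htn n hn)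
  have hstab := discreteNorm_le_of_scheme (e := fun n j => V n j - U n j)
    (r := fun n => schemeResidual α K₁ K₂ 1 (1 - m) h τ N (V n) (V (n + 1))
        (fun j => f (a + j * h) ((n * τ + (n + 1) * τ) / 2)))
    (ρ := C * ((τ / 2) ^ 2 + h ^ 3)) hc hc' hw hK₁ hK₂ hN hh hhN hτ.le hτM (by positivity)
    (fun j hj => ?_) (fun n hn => ?_) (fun n hn => ?_)
    (fun n hn i hi hiN => hU.error_step hτ.ne' V hn hi hiN) (fun n hn i hi hiN => ?_) hn
  · have e : discreteNorm h N (fun i => u (a + i * h) (n * τ) - U n i) =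
        discreteNorm h N (fun j => V n j - U n j) := by
      unfold discreteNorm
      congr 2
      refine Finset.sum_congr rfl fun i hi => ?_
      rw [Finset.mem_Icc] at hi
      beta_reduce
      rw [hVu n hn i (by omega)]
    rw [e]
    refine hstab.trans ?_
    have hA : 0 ≤ T * Real.sqrt (b - a) / (1 - 4 * compactCoeff α 1 (1 - m)) * C := by positivity
    rw [← mul_assoc]
    have hτ2 : 0 ≤ τ ^ 2 := sq_nonneg _
    have hh3 : 0 ≤ h ^ 3 := by positivity
    refine mul_le_mul (le_add_of_nonneg_right zero_le_one) ?_ (by positivity) (by positivity)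
    nlinarith
  · rw [hVu 0 (Nat.zero_le _) j hj, hU.initial j hj, Nat.cast_zero, zero_mul,
      hu.initial _ (hxj j hj), sub_self]
  · rw [hVu n hn 0 (Nat.zero_le _), hU.boundary_left n hn, Nat.cast_zero, zero_mul, add_zero,
      hu.boundary_left _ (htn n hn), sub_self]
  · have hb : a + (N : ℝ) * h = b := by linarith
    rw [hVu n hn N le_rfl, hU.boundary_right n hn, hb, hu.boundary_right _ (htn n hn), sub_self]
  · -- The time levels are `s - δ` and `s + δ` for the midpoint `s` and `δ = τ / 2`.
    have hl' := (htn n hn.le).1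
    have hr' := (htn (n + 1) hn).2
    push_cast at hr'
    have e1 : ((n : ℝ) * τ + (n + 1) * τ) / 2 - τ / 2 = n * τ := by ring
    have e2 : ((n : ℝ) * τ + (n + 1) * τ) / 2 + τ / 2 = (n + 1 : ℕ) * τ := by push_cast; ring
    have := hres h ((n * τ + (n + 1) * τ) / 2) (τ / 2) N hh hhN (by positivity)
      (by rw [e1]; exact hl') (by rw [e2]; push_cast; exact hr') i hi hiN
    rw [e1, e2, mul_div_cancel₀ _ two_ne_zero] at this
    exact this
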